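/- All groups are Hausdorff and written additively. Let $A$ be a locally compact abelian group. For $g\in A$ let $\overline{\langle g\rangle}$ be the closed subgroup generated by $g$. Call $A$ periodic if it is totally disconnected and $\overline{\langle g\rangle}$ is compact for every $g\in A$. Let $\mathrm{SAut}(A)$ be the group of all automorphisms $\alpha$ of the topological group $A$ such that $\alpha(H)=H$ for every closed subgroup $H$ of $A$, with the topology it inherits from $\mathrm{Aut}(A)$ (the coarsest one for which $\alpha\mapsto\alpha$ and $\alpha\mapsto\alpha^{-1}$ are continuous into the space of continuous maps $A\to A$ with the compact-open topology). For a prime $p$ let $A_p$ be the subgroup of all $g\in A$ for which $\overline{\langle g\rangle}$ is a profinite $p$-group; it is a $\mathbb Z_p$-module, where $z\mapsto z\cdot g$ is the unique continuous homomorphism $\mathbb Z_p\to A$ with $1\mapsto g$. Let $\widetilde{\mathbb Z}=\prod_p\mathbb Z_p$ be the ring of profinite integers. (a) If $A$ is not periodic, then $\mathrm{SAut}(A)=\{\mathrm{id},-\mathrm{id}\}$. (b) Let $A$ be periodic. Then every $g\in A$ has a unique decomposition $g=\prod_p g_p$ with $g_p\in A_p$ (an unconditionally convergent sum in additive notation),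 and $\alpha\mapsto(\alpha|_{A_p})_p$ is an isomorphism of topological groups $\mathrm{SAut}(A)\cong\prod_p\mathrm{SAut}(A_p)$. Let $p$ be a prime. If the exponent of $A_p$ is infinite, then $u\mapsto(a\mapsto u\cdot a)$ is an isomorphism of topological groups $\mathbb Z_p^\times\cong\mathrm{SAut}(A_p)$. Otherwise the exponent of $A_p$ is $p^m$ for some $m\ge 0$, and $u\mapsto(a\mapsto u\cdot a)$ induces an isomorphism of topological groups $(\mathbb Z_p/p^m\mathbb Z_p)^\times\cong\mathrm{SAut}(A_p)$, where $\mathbb Z_p/p^m\mathbb Z_p\cong\mathbb Z/p^m\mathbb Z$ as rings. (c) In every case there is a surjective homomorphism $\widetilde{\mathbb Z}^\times\to\mathrm{SAut}(A)$ that is a topological quotient map. If $A$ is periodic, the map sending $z$ to $g\mapsto z\cdot g$ is one, where $z\cdot g=\prod_p z_p\cdot g_p$ for $z=(z_p)_p$ and $g=\prod_p g_p$. (d) If $A$ is periodic, then an automorphism $\alpha$ of the topological group $A$ is in $\mathrm{SAut}(A)$ if and only if there is a unit $z\in\widetilde{\mathbb Z}^\times$ such that $\alpha(g)=z\cdot g=\prod_p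 z_p\cdot g_p$ for all $g=\prod_p g_p$ in $A$. -/

import Mathlib

open Filter Topology

instance Nat.Primes.instFactPrime (p : Nat.Primes) : Fact (p : ℕ).Prime := ⟨p.2⟩

namespace LCA

/-! ### Periodic groups -/

/-- A topological (additive, abelian) group is periodic if it is locally compact, totally
disconnected, and every element generates topologically a compact subgroup. -/
structure IsPeriodic (A : Type*) [AddCommGroup A] [TopologicalSpace A] [IsTopologicalAddGroup A] :
    Prop where
  locallyCompact : LocallyCompactSpace A
  totallyDisconnected : TotallyDisconnectedSpace A
  compact_closure : ∀ g : A,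
    IsCompact ((AddSubgroup.zmultiples g).topologicalClosure : Set A)

/-! ### Primary components -/

/-- A profinite `p`-group: a compact totally disconnected group all of whose open subgroups
have `p`-power index. -/
structure IsProP (p : ℕ) (M : Type*) [AddGroup M] [TopologicalSpace M] : Prop where
  compact : CompactSpace M
  totallyDisconnected : TotallyDisconnectedSpace M
  index : ∀ U : AddSubgroup M, IsOpen (U : Set M) → ∃ k : ℕ, U.index = p ^ k

section Primary

variable {A : Type*} [AddCommGroup A] [TopologicalSpace A] [IsTopologicalAddGroup A]

/-- `g` is a `p`-element if the closed subgroup it generates is a profinite `p`-group. -/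
def IsPElement (p : ℕ) (g : A) : Prop :=
  IsProP p (AddSubgroup.zmultiples g).topologicalClosure

variable {p : ℕ} [hp : Fact p.Prime]

lemma padic_hom_ext {A : Type*} [AddCommGroup A] [TopologicalSpace A] [T2Space A]
    {φ ψ : ℤ_[p] →+ A} (hφ : Continuous φ) (hψ : Continuous ψ)
    (h : φ 1 = ψ 1) : φ = ψ := by
  have := PadicInt.denseRange_intCast (p := p)
  refine DFunLike.coe_injective (this.equalizer hφ hψ ?_)
  funext n
  have e : ((n : ℤ) : ℤ_[p]) = n • (1 : ℤ_[p]) := by simp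
  simp only [Function.comp, e, map_zsmul, h]

lemma exists_span_pow_subset {W : Set ℤ_[p]} (hW : W ∈ 𝓝 (0 : ℤ_[p])) :
    ∃ k : ℕ, ∀ x : ℤ_[p], x ∈ (Ideal.span {(p : ℤ_[p]) ^ k} : Ideal ℤ_[p]) → x ∈ W := by
  obtain ⟨ε, hε, h⟩ := Metric.mem_nhds_iff.1 hW
  obtain ⟨k, hk⟩ := PadicInt.exists_pow_neg_lt p hε
  refine ⟨k, fun x hx => h ?_⟩
  rw [← PadicInt.norm_le_pow_iff_mem_span_pow] at hx
  simpa using lt_of_le_of_lt hx hk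

lemma index_span_pow (k : ℕ) :
    (Ideal.span {(p : ℤ_[p]) ^ k} : Ideal ℤ_[p]).toAddSubgroup.index = p ^ k := by
  have h := AddSubgroup.index_ker (PadicInt.toZModPow (p := p) k).toAddMonoidHom
  have e : (PadicInt.toZModPow (p := p) k).toAddMonoidHom.ker
      = (Ideal.span {(p : ℤ_[p]) ^ k} : Ideal ℤ_[p]).toAddSubgroup := by
    rw [← PadicInt.ker_toZModPow]; rfl
  rw [e] at h
  rw [h]
  have s : Function.Surjective (PadicInt.toZModPow (p := p) k) := ZMod.ringHom_surjective _
  have t : (PadicInt.toZModPow (p := p) k).toAddMonoidHom.range = ⊤ :=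
    AddMonoidHom.range_eq_top.2 s
  rw [t, Nat.card_congr AddSubgroup.topEquiv.toEquiv, Nat.card_zmod]

lemma isOpen_span_pow (k : ℕ) :
    IsOpen ((Ideal.span {(p : ℤ_[p]) ^ k} : Ideal ℤ_[p]) : Set ℤ_[p]) := by
  have : ((Ideal.span {(p : ℤ_[p]) ^ k} : Ideal ℤ_[p]) : Set ℤ_[p])
      = {x | ‖x‖ < (p : ℝ) ^ (-(k : ℤ) + 1)} := by
    ext x
    rw [SetLike.mem_coe, ← PadicInt.norm_le_pow_iff_mem_span_pow,
      PadicInt.norm_le_pow_iff_norm_lt_pow_add_one]; rfl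
  rw [this]
  exact isOpen_lt continuous_norm continuous_const

/-- In a profinite `p`-group `M`, every element is the image of `1` under a continuous
homomorphism `ℤ_p → M`. -/
lemma IsProP.exists_hom {M : Type*} [AddCommGroup M] [TopologicalSpace M]
    [IsTopologicalAddGroup M] [T2Space M] (hM : IsProP p M) (g : M) :
    ∃ φ : ℤ_[p] →+ M, Continuous φ ∧ φ 1 = g := by
  have := hM.compact
  have := hM.totallyDisconnected
  let _ : UniformSpace M := IsTopologicalAddGroup.rightUniformSpace M
  have : IsUniformAddGroup M := isUniformAddGroup_of_addCommGroup
  let S : AddSubgroup ℤ_[p] := (Int.castAddHom ℤ_[p]).range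
  have inj : Function.Injective (Int.castAddHom ℤ_[p]) := Int.cast_injective
  let eqv : ℤ ≃+ S := AddMonoidHom.ofInjective inj
  let f₀ : S →+ M := ((zmultiplesHom M g)).comp eqv.symm.toAddMonoidHom
  have f₀_apply : ∀ n : ℤ, f₀ (eqv n) = n • g := by
    intro n; simp [f₀]
  have f₀_cont : Continuous f₀ := by
    refine continuous_of_continuousAt_zero f₀ ?_
    rw [ContinuousAt, map_zero]
    intro W hW
    obtain ⟨W', ⟨h0, hc⟩, hW'⟩ := (nhds_basis_clopen (0 : M)).mem_iff.1 hW
    obtain ⟨U, hU⟩ := IsTopologicalAddGroup.exist_openAddSubgroup_sub_clopen_nhds_of_zero hc h0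
    obtain ⟨k, hk⟩ := hM.index U.toAddSubgroup U.isOpen'
    rw [mem_map]
    have hs : ((Ideal.span {(p : ℤ_[p]) ^ k} : Ideal ℤ_[p]) : Set ℤ_[p]) ∈ 𝓝 (0 : ℤ_[p]) :=
      (isOpen_span_pow k).mem_nhds (zero_mem _)
    have hs' := continuous_subtype_val.continuousAt (x := (0 : S)) hs
    filter_upwards [hs'] with x hx
    obtain ⟨n, rfl⟩ := eqv.surjective x
    refine hW' (hU ?_)
    rw [f₀_apply]
    have hx' : ((n : ℤ) : ℤ_[p]) ∈ (Ideal.span {(p : ℤ_[p]) ^ k} : Ideal ℤ_[p]) := hx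
    rw [← PadicInt.norm_le_pow_iff_mem_span_pow, PadicInt.norm_int_le_pow_iff_dvd] at hx'
    obtain ⟨m, rfl⟩ := hx'
    rw [mul_comm, mul_zsmul]
    refine zsmul_mem ?_ m
    have := U.toAddSubgroup.nsmul_index_mem g
    rw [hk] at this
    exact_mod_cast this
  let f : S →L[ℤ] M := ⟨f₀.toIntLinearMap, f₀_cont⟩
  let e : S →L[ℤ] ℤ_[p] := ⟨S.subtype.toIntLinearMap, continuous_subtype_val⟩
  have hd : DenseRange e := by
    have := PadicInt.denseRange_intCast (p := p)
    refine this.mono ?_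
    rintro _ ⟨n, rfl⟩
    exact ⟨eqv n, rfl⟩
  have he : IsUniformInducing e := isUniformInducing_val _
  refine ⟨(f.extend e).toLinearMap.toAddMonoidHom, (f.extend e).continuous, ?_⟩
  have h1 : e (eqv 1) = 1 := by
    change ((1 : ℤ) : ℤ_[p]) = 1
    simp
  change f.extend e 1 = g
  rw [← h1, ContinuousLinearMap.extend_eq _ hd he]
  change f₀ (eqv 1) = g
  rw [f₀_apply, one_zsmul]

/-- An element is a `p`-element iff it is the image of `1` under a (necessarily unique)
continuous homomorphism from `ℤ_p`. -/
lemma isPElement_iff [T2Space A] {g : A} :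
    IsPElement p g ↔ ∃ φ : ℤ_[p] →+ A, Continuous φ ∧ φ 1 = g := by
  constructor
  · intro h
    obtain ⟨φ, hφ, h1⟩ := IsProP.exists_hom h
      ⟨g, AddSubgroup.le_topologicalClosure _ (AddSubgroup.mem_zmultiples g)⟩
    exact ⟨(AddSubgroup.subtype _).comp φ, continuous_subtype_val.comp hφ,
      by simp [h1]⟩
  · rintro ⟨φ, hφ, rfl⟩
    set M := (AddSubgroup.zmultiples (φ 1)).topologicalClosure with hMdef
    have hmem : ∀ z, φ z ∈ M := by
      intro z
      refine (PadicInt.denseRange_intCast (p := p)).induction_on (p := fun z => φ z ∈ M) z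
        ?_ ?_
      · exact (AddSubgroup.isClosed_topologicalClosure _).preimage hφ
      · intro n
        refine AddSubgroup.le_topologicalClosure _ ⟨n, ?_⟩
        have e : ((n : ℤ) : ℤ_[p]) = n • (1 : ℤ_[p]) := by simp
        simp only [e, map_zsmul]
    have hle : M ≤ φ.range := by
      refine AddSubgroup.topologicalClosure_minimal _ ?_ ?_
      · rw [AddSubgroup.zmultiples_le]; exact ⟨1, rfl⟩
      · rw [AddMonoidHom.coe_range]; exact (isCompact_range hφ).isClosed
    let ψ : ℤ_[p] →+ M := φ.codRestrict M hmem
    have hψ : Continuous ψ := hφ.subtype_mk hmem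
    have hs : Function.Surjective ψ := by
      rintro ⟨x, hx⟩
      obtain ⟨z, rfl⟩ := hle hx
      exact ⟨z, rfl⟩
    have hc : CompactSpace M := hs.compactSpace hψ
    have key : ∀ U ∈ 𝓝 (0 : M), ∃ V : OpenAddSubgroup M, (V : Set M) ⊆ U := by
      intro U hU
      obtain ⟨k, hk⟩ := exists_span_pow_subset
        (hψ.continuousAt (x := 0) (by rwa [map_zero]) : ψ ⁻¹' U ∈ 𝓝 0)
      let V := (Ideal.span {(p : ℤ_[p]) ^ k} : Ideal ℤ_[p]).toAddSubgroup.map ψ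
      have hVc : IsClosed (V : Set M) := by
        have hcl : IsClosed ((Ideal.span {(p : ℤ_[p]) ^ k} : Ideal ℤ_[p]).toAddSubgroup :
            Set ℤ_[p]) := AddSubgroup.isClosed_of_isOpen _ (isOpen_span_pow k)
        exact (hcl.isCompact.image hψ).isClosed
      have hVi : V.FiniteIndex := by
        refine ⟨fun h0 => ?_⟩
        have hd := AddSubgroup.index_map_dvd
          (Ideal.span {(p : ℤ_[p]) ^ k} : Ideal ℤ_[p]).toAddSubgroup hs
        rw [index_span_pow, show (AddSubgroup.map ψ _).index = 0 from h0,
          zero_dvd_iff] at hd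
        exact pow_ne_zero k hp.out.ne_zero hd
      refine ⟨⟨V, AddSubgroup.isOpen_of_isClosed_of_finiteIndex V hVc⟩, ?_⟩
      rintro _ ⟨z, hz, rfl⟩
      exact hk z hz
    have : NonarchimedeanAddGroup M := ⟨key⟩
    refine ⟨hc, inferInstance, fun U hU => ?_⟩
    have h0 : (U : Set M) ∈ 𝓝 (0 : M) := hU.mem_nhds (zero_mem U)
    obtain ⟨k, hk⟩ := exists_span_pow_subset
      (hψ.continuousAt (x := 0) (by rwa [map_zero]) : ψ ⁻¹' (U : Set M) ∈ 𝓝 0)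
    have hd : U.index ∣ p ^ k := by
      rw [← AddSubgroup.index_comap_of_surjective U hs, ← index_span_pow (p := p) k]
      exact AddSubgroup.index_dvd_of_le fun z hz => hk z hz
    obtain ⟨j, -, hj⟩ := (Nat.dvd_prime_pow hp.out).1 hd
    exact ⟨j, hj⟩

variable (A p) in
/-- The `p`-primary component (`p`-Sylow subgroup) `A_p`: the subgroup of all `p`-elements. -/
def primaryComponent [T2Space A] : AddSubgroup A where
  carrier := {g | IsPElement p g}
  zero_mem' := isPElement_iff.2 ⟨0, continuous_const, rfl⟩
  add_mem' := by
    intro a b ha hb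
    obtain ⟨φ, hφ, rfl⟩ := isPElement_iff.1 ha
    obtain ⟨ψ, hψ, rfl⟩ := isPElement_iff.1 hb
    exact isPElement_iff.2 ⟨φ + ψ, hφ.add hψ, rfl⟩
  neg_mem' := by
    intro a ha
    obtain ⟨φ, hφ, rfl⟩ := isPElement_iff.1 ha
    exact isPElement_iff.2 ⟨-φ, hφ.neg, rfl⟩

variable [T2Space A]

lemma existsUnique_hom (g : primaryComponent A p) :
    ∃! φ : ℤ_[p] →+ A, Continuous φ ∧ φ 1 = (g : A) := by
  obtain ⟨φ, hφ, h1⟩ := isPElement_iff.1 g.2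
  exact ⟨φ, ⟨hφ, h1⟩, fun ψ hψ => padic_hom_ext hψ.1 hφ (hψ.2.trans h1.symm)⟩

/-- The continuous homomorphism `z ↦ z • g` from `ℤ_p` to `A` with `1 ↦ g`, for `g ∈ A_p`. -/
noncomputable def scalarHom (g : primaryComponent A p) : ℤ_[p] →+ A :=
  (existsUnique_hom g).choose

lemma continuous_scalarHom (g : primaryComponent A p) : Continuous (scalarHom g) :=
  (existsUnique_hom g).choose_spec.1.1

lemma scalarHom_one (g : primaryComponent A p) : scalarHom g 1 = (g : A) :=
  (existsUnique_hom g).choose_spec.1.2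

lemma scalarHom_unique (g : primaryComponent A p) {φ : ℤ_[p] →+ A} (hφ : Continuous φ)
    (h : φ 1 = (g : A)) : φ = scalarHom g :=
  padic_hom_ext hφ (continuous_scalarHom g) (h.trans (scalarHom_one g).symm)

lemma scalarHom_mem (g : primaryComponent A p) (z : ℤ_[p]) :
    scalarHom g z ∈ primaryComponent A p :=
  isPElement_iff.2 ⟨(scalarHom g).comp (AddMonoidHom.mulRight z),
    (continuous_scalarHom g).comp (continuous_mul_const z), by simp⟩

/-- The natural `ℤ_p`-module structure on `A_p`: the action of `ℤ` extended by continuity,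
i.e. `z ↦ z • g` is the continuous homomorphism `ℤ_p → A` that maps `1` to `g`. -/
noncomputable instance : Module ℤ_[p] (primaryComponent A p) where
  smul z g := ⟨scalarHom g z, scalarHom_mem g z⟩
  one_smul g := Subtype.ext (scalarHom_one g)
  mul_smul z w g := by
    refine Subtype.ext ?_
    change scalarHom g (z * w) = scalarHom ⟨scalarHom g w, scalarHom_mem g w⟩ z
    rw [← scalarHom_unique ⟨scalarHom g w, scalarHom_mem g w⟩
      (φ := (scalarHom g).comp (AddMonoidHom.mulRight w))
      ((continuous_scalarHom g).comp (continuous_mul_const w)) (by simp)]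
    rfl
  smul_zero z := by
    refine Subtype.ext ?_
    change scalarHom (0 : primaryComponent A p) z = 0
    rw [← scalarHom_unique (0 : primaryComponent A p) (φ := 0) continuous_const rfl]
    rfl
  smul_add z g h := by
    refine Subtype.ext ?_
    change scalarHom (g + h) z = scalarHom g z + scalarHom h z
    rw [← scalarHom_unique (g + h) (φ := scalarHom g + scalarHom h)
      ((continuous_scalarHom g).add (continuous_scalarHom h))
      (by simp [scalarHom_one])]
    rfl
  add_smul z w g := Subtype.ext (map_add (scalarHom g) z w)
  zero_smul g := Subtype.ext (map_zero (scalarHom g))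

end Primary

/-! ### Scalar automorphisms -/

section SAut

variable (A : Type*) [AddCommGroup A] [TopologicalSpace A]

/-- The group of scalar automorphisms: the automorphisms `α` of the topological group `A`
(continuous with continuous inverse) such that `α(H) = H` for every closed subgroup `H`. -/
def SAut : Subgroup (A ≃L[ℤ] A) where
  carrier := {α | ∀ H : AddSubgroup A, IsClosed (H : Set A) → α '' (H : Set A) = H}
  one_mem' := by
    intro H _
    change id '' (H : Set A) = H
    simp
  mul_mem' := by
    intro α β hα hβ H hH
    change (α ∘ β) '' (H : Set A) = H
    rw [Set.image_comp, hβ H hH, hα H hH]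
  inv_mem' := by
    intro α hα H hH
    change α.symm '' (H : Set A) = H
    conv_lhs => rw [← hα H hH]
    rw [← Set.image_comp]
    simp

/-- The topology of the automorphism group: the coarsest topology making both `α ↦ α` and
`α ↦ α⁻¹` continuous for the compact-open topology. -/
instance : TopologicalSpace (SAut A) :=
  TopologicalSpace.induced
    (fun α => (((α : A ≃L[ℤ] A) : C(A, A)), (((α⁻¹ : SAut A) : A ≃L[ℤ] A) : C(A, A))))
    inferInstance

end SAut

/-! ### Scalar multiplication by profinite integers -/

/-- The ring of profinite integers, as the topological ring `∏ p, ℤ_p`. -/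
abbrev ProfiniteInt : Type := ∀ p : Nat.Primes, ℤ_[(p : ℕ)]

section Scalar

variable {A : Type*} [AddCommGroup A] [TopologicalSpace A] [IsTopologicalAddGroup A] [T2Space A]

/-- `c = (g_p)_p` is the decomposition `g = ∏_p g_p` of `g` into primary components `g_p ∈ A_p`:
the (additively written, unordered) sum of the `g_p` converges to `g`. -/
def IsPrimaryDecomposition (g : A) (c : ∀ p : Nat.Primes, primaryComponent A (p : ℕ)) : Prop :=
  HasSum (fun p => (c p : A)) g

/-- `h = z • g`, the componentwise scalar multiple: if `g = ∏_p g_p` then `h = ∏_p z_p • g_p`. -/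
def IsScalarMultiple (z : ProfiniteInt) (g h : A) : Prop :=
  ∃ c : ∀ p : Nat.Primes, primaryComponent A (p : ℕ),
    IsPrimaryDecomposition g c ∧ IsPrimaryDecomposition h fun p => z p • c p

end Scalar

end LCA

/-! A scalar automorphism `α` is controlled by testing it on closed subgroups that have few
automorphisms.

Non-periodic case. Suppose first that some cyclic subgroup `⟨g⟩` has non-compact closure. By Weil's
lemma it is closed and infinite cyclic, so `α g = ±g`, and comparing `g` with `g + h` carries the
sign to the elements `h` of compact type. Otherwise `A` is not totally disconnected, and every
element lies in a compact open subgroup `K`, again not totally disconnected. Characters separate the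
points of `K` (a Peter–Weyl argument), which yields a character `χ₀` of `K` onto the circle. On `K /
ker χ₀`, `α` induces a continuous injective endomorphism of the circle, so the identity or the
inversion; multiplying other characters by `χ₀` shows that all of them see the same sign. Either way
`α x = ±x` for each `x`, and the sign is global because a group is not the union of two proper
subgroups.

Periodic case. The action of `ℤ` extends to a continuous action of `∏ p, ℤ_p`, whose idempotents
project `A` onto the `A_p` and give the primary decomposition. Since `ℤ` is dense, multiplication by
a unit preserves closed subgroups. Conversely, `α a ∈ ℤ_p • a` for each `a ∈ A_p`. A scalar that is
right for `a` is right for every `b` killed by the annihilator of `a` (`eq_zero_of_annihilator_le`).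
The ideals of `ℤ_p` form a chain, so compactness of `ℤ_p` produces one scalar for all of `A_p`. Thus
the units map onto `SAut A`. The unit groups are compact and `SAut` is Hausdorff, so the topological
claims follow from the algebraic ones. -/

namespace LCA

/-! ### Compact and discrete cyclic subgroups -/

section CompactElements

open scoped Pointwise

variable {A : Type*} [AddCommGroup A] [TopologicalSpace A] [IsTopologicalAddGroup A]

lemma isCompact_sup {K L : AddSubgroup A} (hK : IsCompact (K : Set A))
    (hL : IsCompact (L : Set A)) : IsCompact ((K ⊔ L : AddSubgroup A) : Set A) := by
  convert hK.add hL using 1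
  ext x
  exact AddSubgroup.mem_sup

lemma exists_compact_addSubgroup_of_finset
    (hA : ∀ g : A, IsCompact ((AddSubgroup.zmultiples g).topologicalClosure : Set A))
    (F : Finset A) : ∃ L : AddSubgroup A, IsCompact (L : Set A) ∧ (F : Set A) ⊆ L := by
  classical
  induction F using Finset.induction_on with
  | empty => exact ⟨⊥, by simp, by simp⟩
  | insert a F _ ih =>
    obtain ⟨L, hL, hF⟩ := ih
    refine ⟨(AddSubgroup.zmultiples a).topologicalClosure ⊔ L, ?_, ?_⟩
    · exact isCompact_sup (hA a) hL
    · rw [Finset.coe_insert, Set.insert_subset_iff]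
      exact ⟨AddSubgroup.mem_sup_left
        (AddSubgroup.le_topologicalClosure _ (AddSubgroup.mem_zmultiples a)),
        fun x hx => AddSubgroup.mem_sup_right (hF hx)⟩

/-- If every element of a locally compact group generates a relatively compact subgroup, so does
every compact subset. -/
lemma exists_compact_open_addSubgroup [LocallyCompactSpace A]
    (hA : ∀ g : A, IsCompact ((AddSubgroup.zmultiples g).topologicalClosure : Set A))
    {S : Set A} (hS : IsCompact S) :
    ∃ H : AddSubgroup A, IsCompact (H : Set A) ∧ IsOpen (H : Set A) ∧ S ⊆ H := by
  obtain ⟨V, hV, hV0⟩ := exists_compact_mem_nhds (0 : A)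
  set W : Set A := (V ∪ S) ∪ -(V ∪ S) with hWdef
  have hW : IsCompact W := (hV.union hS).union (hV.union hS).neg
  have hVW : V ⊆ W := fun x hx => Or.inl (Or.inl hx)
  have h0 : (0 : A) ∈ V := mem_of_mem_nhds hV0
  have hneg : ∀ x ∈ W, -x ∈ W := by
    rintro x (hx | hx)
    · exact Or.inr (by simpa using hx)
    · exact Or.inl hx
  obtain ⟨F, -, hF⟩ := (hW.add hW).elim_nhds_subcover (fun x => (fun y => y - x) ⁻¹' V)
    (fun x _ => (continuous_id.sub continuous_const).continuousAt.preimage_mem_nhds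
      (by simpa using hV0))
  obtain ⟨L, hL, hFL⟩ := exists_compact_addSubgroup_of_finset hA F
  -- Finitely many translates `f + V`, `f ∈ F ⊆ L`, cover `W + W`; hence `W + W ⊆ W + L`, and the
  -- compact set `W + L` is stable under addition.
  have hadd : ∀ x ∈ W, ∀ y ∈ W, ∃ k ∈ W, ∃ l ∈ L, x + y = k + l := by
    intro x hx y hy
    obtain ⟨f, hf, h⟩ := Set.mem_iUnion₂.1 (hF (Set.add_mem_add hx hy))
    exact ⟨_, hVW h, f, hFL hf, by simp⟩
  let H : AddSubgroup A :=
    { carrier := W + (L : Set A)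
      zero_mem' := ⟨0, hVW h0, 0, L.zero_mem, add_zero 0⟩
      add_mem' := by
        rintro _ _ ⟨a, ha, l, hl, rfl⟩ ⟨b, hb, m, hm, rfl⟩
        obtain ⟨k, hk, n, hn, e⟩ := hadd a ha b hb
        refine ⟨k, hk, n + (l + m), L.add_mem hn (L.add_mem hl hm), ?_⟩
        change k + (n + (l + m)) = a + l + (b + m)
        rw [← add_assoc, ← e]; abel
      neg_mem' := by
        rintro _ ⟨a, ha, l, hl, rfl⟩
        exact ⟨-a, hneg a ha, -l, L.neg_mem hl, by simp [add_comm]⟩ }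
  have hWH : W ⊆ H := fun x hx => ⟨x, hx, 0, L.zero_mem, add_zero x⟩
  refine ⟨H, hW.add hL, H.isOpen_of_mem_nhds (g := 0) (mem_of_superset hV0 (hVW.trans hWH)),
    fun x hx => hWH (Or.inl (Or.inr hx))⟩

/-- Weil's lemma: a cyclic subgroup without compact closure is discrete. -/
lemma exists_nhds_zsmul_mem_imp_eq_zero [LocallyCompactSpace A] [T2Space A] {g : A}
    (hg : ¬ IsCompact ((AddSubgroup.zmultiples g).topologicalClosure : Set A)) :
    ∃ U ∈ 𝓝 (0 : A), ∀ n : ℤ, n • g ∈ U → n = 0 := by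
  by_contra! hdisc
  refine hg ?_
  -- Returns to `U` occur at arbitrarily large `n`: use multiples of a period of `g` if there is
  -- one, and otherwise remove from `U ∩ -U` the finitely many `n • g` with `0 < |n| ≤ N`.
  have hret : ∀ U ∈ 𝓝 (0 : A), ∀ N : ℕ, ∃ n : ℤ, N < n ∧ n • g ∈ U := by
    intro U hU N
    by_cases hfin : ∃ n : ℤ, n ≠ 0 ∧ n • g = 0
    · obtain ⟨n, hn, hng⟩ := hfin
      refine ⟨|n| * (N + 1), ?_, ?_⟩
      · have : 1 ≤ |n| := Int.one_le_abs hn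
        nlinarith
      · have : |n| • g = 0 := by
          rcases abs_choice n with h | h <;> simp [h, hng]
        rw [mul_comm, mul_smul, this, smul_zero]
        exact mem_of_mem_nhds hU
    · push Not at hfin
      set E : Set A := (fun n : ℤ => n • g) '' (Set.Icc (-N : ℤ) N \ {0}) with hE
      have hEf : E.Finite := ((Set.finite_Icc _ _).sdiff).image _
      have h0E : (0 : A) ∉ E := by
        rintro ⟨n, ⟨-, hn⟩, h⟩
        exact hfin n hn h
      have hU' : (U ∩ -U) ∩ Eᶜ ∈ 𝓝 (0 : A) := by
        refine inter_mem (inter_mem hU ?_) (hEf.isClosed.isOpen_compl.mem_nhds h0E)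
        exact neg_mem_nhds_zero A hU
      obtain ⟨n, ⟨⟨h1, h2⟩, h3⟩, hn⟩ := hdisc _ hU'
      have hNn : (N : ℤ) < |n| := by
        by_contra! hle
        exact h3 ⟨n, ⟨abs_le.1 hle, hn⟩, rfl⟩
      refine ⟨|n|, hNn, ?_⟩
      rcases abs_choice n with h | h
      · rwa [h]
      · rw [h, neg_smul]; exact h2
  have hret' : ∀ x ∈ closure (AddSubgroup.zmultiples g : Set A), ∀ U ∈ 𝓝 (0 : A),
      ∃ n : ℕ, 0 < n ∧ n • g - x ∈ U := by
    intro x hx U hU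
    obtain ⟨W, hW, hWU⟩ := exists_nhds_zero_half hU
    have hxW : (fun y => y - x) ⁻¹' W ∈ 𝓝 x :=
      (continuous_id.sub continuous_const).continuousAt.preimage_mem_nhds (by simpa using hW)
    obtain ⟨_, hm, m, rfl⟩ := mem_closure_iff_nhds.1 hx _ hxW
    obtain ⟨k, hk, hkW⟩ := hret W hW m.natAbs
    have hpos : 0 < k + m := by omega
    refine ⟨(k + m).toNat, by omega, ?_⟩
    have e : (k + m).toNat • g = (k + m) • g := by
      rw [← natCast_zsmul, Int.toNat_of_nonneg hpos.le]
    rw [e, add_smul, add_sub_assoc]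
    exact hWU _ hkW _ hm
  obtain ⟨V, hV, hV0⟩ := exists_compact_mem_nhds (0 : A)
  set H : Set A := closure (AddSubgroup.zmultiples g : Set A) with hH
  have hVH : IsCompact (V ∩ H) := hV.inter_right isClosed_closure
  obtain ⟨T, hT⟩ := hVH.elim_finite_subcover
    (fun n : ℕ => {y : A | 0 < n ∧ y - n • g ∈ interior V})
    (fun n => by
      by_cases hn : 0 < n
      · simp only [hn, true_and]
        exact isOpen_interior.preimage (continuous_id.sub continuous_const)
      · simp [hn]) (by
      rintro y ⟨-, hy⟩
      obtain ⟨n, hn, h⟩ := hret' y hy (-interior V) (neg_mem_nhds_zero A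
        (interior_mem_nhds.2 hV0))
      refine Set.mem_iUnion.2 ⟨n, hn, ?_⟩
      simpa using h)
  have hcov : H ⊆ ⋃ n ∈ Finset.range (T.sup id + 1), (fun v : A => n • g - v) '' V := by
    classical
    intro x hx
    have hex := hret' x hx V hV0
    -- For the least `n`, the point `n • g - x` of `V ∩ H` lies in `k • g + V` for some `k ∈ T`. If
    -- `k < n`, then `n - k` would be a smaller choice. So `n` is bounded by the maximum of `T`, and
    -- `H` lies in finitely many compact sets `n • g - V`.
    obtain ⟨hn, hnV⟩ := Nat.find_spec hex
    set n := Nat.find hex with hndef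
    have hgH : n • g - x ∈ H :=
      (AddSubgroup.zmultiples g).topologicalClosure.sub_mem
        (AddSubgroup.le_topologicalClosure _ (nsmul_mem (AddSubgroup.mem_zmultiples g) n)) hx
    obtain ⟨k, hkT, hk0, hk⟩ := Set.mem_iUnion₂.1 (hT ⟨hnV, hgH⟩)
    have hnk : n ≤ k := by
      by_contra! hlt
      refine Nat.find_min hex (m := n - k) (by omega) ⟨by omega, ?_⟩
      have e : (n - k) • g - x = n • g - x - k • g := by
        rw [sub_nsmul _ hlt.le]; abel
      rw [e]
      exact interior_subset hk
    refine Set.mem_iUnion₂.2 ⟨n, ?_, n • g - x, hnV, by simp⟩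
    have : k ≤ T.sup id := Finset.le_sup (f := id) hkT
    simp; omega
  refine IsCompact.of_isClosed_subset (Finset.isCompact_biUnion _ fun n _ =>
    hV.image (continuous_const.sub continuous_id)) ?_ hcov
  exact isClosed_closure

lemma isClosed_zmultiples_of_not_isCompact [LocallyCompactSpace A] [T2Space A] {g : A}
    (hg : ¬ IsCompact ((AddSubgroup.zmultiples g).topologicalClosure : Set A)) :
    IsClosed (AddSubgroup.zmultiples g : Set A) := by
  obtain ⟨U, hU, h⟩ := exists_nhds_zsmul_mem_imp_eq_zero hg
  have : DiscreteTopology (AddSubgroup.zmultiples g) := by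
    refine discreteTopology_of_isOpen_singleton_zero ?_
    refine isOpen_iff_mem_nhds.2 fun x hx => ?_
    rw [Set.mem_singleton_iff.1 hx]
    refine mem_of_superset (continuous_subtype_val.continuousAt.preimage_mem_nhds
      (x := (0 : AddSubgroup.zmultiples g)) hU) ?_
    rintro ⟨_, n, rfl⟩ hn
    simp [h n hn]
  exact AddSubgroup.isClosed_of_discrete

/-- By division with remainder, `⟨g⟩` lies in the compact union of the translates `k • g + K` with
`0 ≤ k ≤ |n|`. -/
lemma isCompact_topologicalClosure_zmultiples [T2Space A] {K : AddSubgroup A}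
    (hK : IsCompact (K : Set A)) {g : A} {n : ℤ} (hn : n ≠ 0) (h : n • g ∈ K) :
    IsCompact ((AddSubgroup.zmultiples g).topologicalClosure : Set A) := by
  have hc : IsCompact (⋃ k ∈ Finset.Icc 0 |n|, (fun x : A => k • g + x) '' (K : Set A)) :=
    Finset.isCompact_biUnion _ fun k _ => hK.image (continuous_const.add continuous_id)
  refine hc.of_isClosed_subset isClosed_closure (closure_minimal ?_ hc.isClosed)
  rintro _ ⟨m, rfl⟩
  refine Set.mem_iUnion₂.2 ⟨m % n, ?_, (m / n) • (n • g), K.zsmul_mem h _, ?_⟩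
  · rw [Finset.mem_Icc]
    exact ⟨Int.emod_nonneg _ hn, (Int.emod_lt_abs _ hn).le⟩
  · change (m % n) • g + (m / n) • (n • g) = m • g
    rw [smul_smul, ← add_smul, mul_comm, Int.emod_add_mul_ediv]

lemma zsmul_ne_zero_of_not_isCompact [LocallyCompactSpace A] [T2Space A] {g : A}
    (hg : ¬ IsCompact ((AddSubgroup.zmultiples g).topologicalClosure : Set A)) {n : ℤ}
    (hn : n • g = 0) : n = 0 := by
  obtain ⟨U, hU, h⟩ := exists_nhds_zsmul_mem_imp_eq_zero hg
  exact h n (by rw [hn]; exact mem_of_mem_nhds hU)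

end CompactElements

/-! ### Scalar automorphisms in the presence of a non-compact cyclic closure -/

section Discrete

variable {A : Type*} [AddCommGroup A] [TopologicalSpace A]

lemma SAut.apply_mem (α : SAut A) {H : AddSubgroup A} (hH : IsClosed (H : Set A)) {x : A}
    (hx : x ∈ H) : (α : A ≃L[ℤ] A) x ∈ H := by
  have := α.2 H hH
  exact this.subset ⟨x, hx, rfl⟩

lemma SAut.apply_mem_iff (α : SAut A) {H : AddSubgroup A} (hH : IsClosed (H : Set A)) {x : A} :
    (α : A ≃L[ℤ] A) x ∈ H ↔ x ∈ H := by
  refine ⟨fun hx => ?_, SAut.apply_mem α hH⟩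
  have : (α : A ≃L[ℤ] A) x ∈ (α : A ≃L[ℤ] A) '' (H : Set A) := by rwa [α.2 H hH]
  obtain ⟨y, hy, hxy⟩ := this
  rwa [← (α : A ≃L[ℤ] A).injective hxy]

lemma neg_mem_SAut [IsTopologicalAddGroup A] : ContinuousLinearEquiv.neg ℤ ∈ SAut A := by
  intro H _
  ext x
  constructor
  · rintro ⟨y, hy, rfl⟩
    exact H.neg_mem hy
  · intro hx
    exact ⟨-x, H.neg_mem hx, neg_neg x⟩

/-- A group is not the union of two proper subgroups. -/
lemma eq_one_or_eq_neg_of_forall [IsTopologicalAddGroup A] {α : A ≃L[ℤ] A}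
    (h : ∀ x, α x = x ∨ α x = -x) : α = 1 ∨ α = ContinuousLinearEquiv.neg ℤ := by
  by_contra! hne
  obtain ⟨h1, h2⟩ := hne
  obtain ⟨x, hx⟩ : ∃ x, α x ≠ x := by
    by_contra! hc
    exact h1 (ContinuousLinearEquiv.ext (funext hc))
  obtain ⟨y, hy⟩ : ∃ y, α y ≠ -y := by
    by_contra! hc
    exact h2 (ContinuousLinearEquiv.ext (funext hc))
  have hx' := (h x).resolve_left hx
  have hy' := (h y).resolve_right hy
  rcases h (x + y) with e | e <;> rw [map_add, hx', hy'] at e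
  · exact hx (hx'.trans (add_right_cancel e))
  · rw [neg_add] at e
    exact hy (hy'.trans (add_left_cancel e))

variable [IsTopologicalAddGroup A] [LocallyCompactSpace A] [T2Space A]

/-- The group `⟨g⟩` is closed and infinite cyclic, and `α`, `α⁻¹` multiply `g` by integers `n`, `m`
with `m * n = 1`. -/
lemma SAut.apply_eq_or_of_not_isCompact (α : SAut A) {g : A}
    (hg : ¬ IsCompact ((AddSubgroup.zmultiples g).topologicalClosure : Set A)) :
    (α : A ≃L[ℤ] A) g = g ∨ (α : A ≃L[ℤ] A) g = -g := by
  have hcl := isClosed_zmultiples_of_not_isCompact hg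
  obtain ⟨n, hn⟩ := SAut.apply_mem α hcl (AddSubgroup.mem_zmultiples g)
  obtain ⟨m, hm⟩ := SAut.apply_mem α⁻¹ hcl (AddSubgroup.mem_zmultiples g)
  have e : (α : A ≃L[ℤ] A) (((α⁻¹ : SAut A) : A ≃L[ℤ] A) g) = g :=
    (α : A ≃L[ℤ] A).apply_symm_apply g
  simp only at hn hm
  rw [← hm, map_zsmul, ← hn, smul_smul] at e
  replace e : (m * n - 1) • g = 0 := by rw [sub_smul, e, one_smul, sub_self]
  have := zsmul_ne_zero_of_not_isCompact hg e
  rcases Int.eq_one_or_neg_one_of_mul_eq_one' (u := m) (v := n) (by linarith) with h | h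
  · left; rw [← hn, h.2, one_zsmul]
  · right; rw [← hn, h.2]; simp

/-- An element `h` of compact type is reached through `g + h`, which is again of non-compact type.
Different signs at `g` and `g + h` would put `2 • g` into the compact closure of `⟨h⟩`. -/
lemma SAut.eq_one_or_eq_neg_of_not_isCompact (α : SAut A) {g : A}
    (hg : ¬ IsCompact ((AddSubgroup.zmultiples g).topologicalClosure : Set A)) :
    (α : A ≃L[ℤ] A) = 1 ∨ (α : A ≃L[ℤ] A) = ContinuousLinearEquiv.neg ℤ := by
  refine eq_one_or_eq_neg_of_forall fun h => ?_
  by_cases hh : IsCompact ((AddSubgroup.zmultiples h).topologicalClosure : Set A)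
  swap
  · exact SAut.apply_eq_or_of_not_isCompact α hh
  set K := (AddSubgroup.zmultiples h).topologicalClosure with hK
  have hhK : h ∈ K := AddSubgroup.le_topologicalClosure _ (AddSubgroup.mem_zmultiples h)
  have hKc : IsClosed (K : Set A) := AddSubgroup.isClosed_topologicalClosure _
  have hαK : (α : A ≃L[ℤ] A) h ∈ K := SAut.apply_mem α hKc hhK
  have hne : ∀ n : ℤ, n • g ∈ K → n = 0 := by
    intro n hn
    by_contra hn0
    exact hg (isCompact_topologicalClosure_zmultiples hh hn0 hn)
  have hgh : ¬ IsCompact ((AddSubgroup.zmultiples (g + h)).topologicalClosure : Set A) := by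
    intro hc
    refine hg (isCompact_topologicalClosure_zmultiples (isCompact_sup hc hh) one_ne_zero ?_)
    rw [one_zsmul, ← add_sub_cancel_right g h]
    refine AddSubgroup.sub_mem _ (AddSubgroup.mem_sup_left ?_) (AddSubgroup.mem_sup_right hhK)
    rw [add_sub_cancel_right]
    exact AddSubgroup.le_topologicalClosure _ (AddSubgroup.mem_zmultiples _)
  rcases SAut.apply_eq_or_of_not_isCompact α hg with h1 | h1 <;>
  rcases SAut.apply_eq_or_of_not_isCompact α hgh with h2 | h2 <;>
  rw [map_add, h1] at h2
  · exact Or.inl (add_left_cancel h2)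
  · have e : (2 : ℤ) • g = -(h + (α : A ≃L[ℤ] A) h) := by
      have h3 : g = -(g + h) - (α : A ≃L[ℤ] A) h := by rw [← h2]; abel
      rw [two_zsmul]; nth_rw 1 [h3]; abel
    have := hne 2 (e ▸ K.neg_mem (K.add_mem hhK hαK))
    omega
  · have e : (2 : ℤ) • g = (α : A ≃L[ℤ] A) h - h := by
      have h3 : g = (α : A ≃L[ℤ] A) h - (g + h) := by rw [← h2]; abel
      rw [two_zsmul]; nth_rw 1 [h3]; abel
    have := hne 2 (e ▸ K.sub_mem hαK hhK)
    omega
  · rw [neg_add] at h2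
    exact Or.inr (add_left_cancel h2)

end Discrete

/-! ### Unitary representations of compact abelian groups -/

section PeterWeyl

open MeasureTheory

/-- A commuting family of endomorphisms of a nonzero finite-dimensional complex vector space that
preserves a nonzero subspace `E` has a common eigenvector in `E`. -/
lemma exists_common_eigenvector {ι V : Type*} [AddCommGroup V] [Module ℂ V]
    (U : ι → V →ₗ[ℂ] V) (hcomm : ∀ s t x, U s (U t x) = U t (U s x))
    (E : Submodule ℂ V) [FiniteDimensional ℂ E] (hE : E ≠ ⊥) (hU : ∀ t, ∀ x ∈ E, U t x ∈ E) :
    ∃ e ∈ E, e ≠ 0 ∧ ∀ t, ∃ c : ℂ, U t e = c • e := by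
  obtain ⟨n, hn⟩ : ∃ n, Module.finrank ℂ E = n := ⟨_, rfl⟩
  induction n using Nat.strong_induction_on generalizing E with
  | _ n ih =>
  -- If some `U t` is not scalar on `E`, an eigenspace of it in `E` is nonzero, proper and, by
  -- commutation, stable under the whole family.
  by_cases hsc : ∀ t, ∃ c : ℂ, ∀ x ∈ E, U t x = c • x
  · obtain ⟨e, he, he0⟩ := E.ne_bot_iff.1 hE
    exact ⟨e, he, he0, fun t => (hsc t).imp fun c hc => hc e he⟩
  · push Not at hsc
    obtain ⟨t, ht⟩ := hsc
    have : Nontrivial E := Submodule.nontrivial_iff_ne_bot.2 hE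
    obtain ⟨c, hc⟩ := Module.End.exists_eigenvalue ((U t).restrict (hU t))
    obtain ⟨⟨v, hvE⟩, hv⟩ := hc.exists_hasEigenvector
    set E' : Submodule ℂ V := E ⊓ LinearMap.ker (U t - c • LinearMap.id) with hE'
    have hmem : ∀ x, x ∈ E' ↔ x ∈ E ∧ U t x = c • x := by
      intro x
      simp [hE', sub_eq_zero]
    have hlt : E' < E := by
      refine lt_of_le_of_ne inf_le_left fun h => ?_
      obtain ⟨x, hx, hxc⟩ := ht c
      exact hxc ((hmem x).1 (h ▸ hx)).2
    have : FiniteDimensional ℂ E' := Submodule.finiteDimensional_of_le hlt.le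
    obtain ⟨e, he, h⟩ := ih _ (hn ▸ Submodule.finrank_lt_finrank_of_lt hlt) E'
      (E'.ne_bot_iff.2 ⟨v, (hmem v).2 ⟨hvE, by simpa using congrArg Subtype.val hv.apply_eq_smul⟩,
        fun h0 => hv.2 (Subtype.ext h0)⟩)
      (fun s x hx => (hmem _).2 ⟨hU s x ((hmem x).1 hx).1, by
        rw [hcomm, ((hmem x).1 hx).2, map_smul]⟩) rfl
    exact ⟨e, hlt.le he, h⟩

variable {H : Type*} [NormedAddCommGroup H] [InnerProductSpace ℂ H] [CompleteSpace H]

local notation "⟪" x ", " y "⟫" => inner ℂ x y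

/-- The average over a compact group of the rank one operators attached to an orbit. -/
lemma exists_averaged_operator {G : Type*} [TopologicalSpace G] [CompactSpace G]
    [MeasurableSpace G] [BorelSpace G] (μ : Measure G) [IsProbabilityMeasure μ]
    (U : G → H →ₗᵢ[ℂ] H)
    (hcont : ∀ x, Continuous fun t => U t x) (v : H) :
    ∃ T : H →L[ℂ] H, (∀ w, T w = ∫ t, ⟪U t v, w⟫ • U t v ∂μ) ∧ IsCompactOperator T := by
  have hc : ∀ w, Continuous fun t => ⟪U t v, w⟫ • U t v := fun w =>
    ((hcont v).inner continuous_const).smul (hcont v)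
  have hint : ∀ w, Integrable (fun t => ⟪U t v, w⟫ • U t v) μ := fun w =>
    (hc w).integrable_of_hasCompactSupport (HasCompactSupport.of_compactSpace _)
  have hbd : ∀ w t, ‖⟪U t v, w⟫‖ ≤ ‖v‖ * ‖w‖ := fun w t => by
    simpa using norm_inner_le_norm (𝕜 := ℂ) (U t v) w
  let T₀ : H →ₗ[ℂ] H :=
    { toFun := fun w => ∫ t, ⟪U t v, w⟫ • U t v ∂μ
      map_add' := fun x y => by
        simp only [inner_add_right, add_smul]
        exact integral_add (hint x) (hint y)
      map_smul' := fun c x => by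
        simp only [inner_smul_right, mul_smul, RingHom.id_apply]
        exact integral_smul c _ }
  have hT₀ : ∀ w, T₀ w = ∫ t, ⟪U t v, w⟫ • U t v ∂μ := fun w => rfl
  have hcomp : IsCompactOperator T₀ := by
    -- The values of `T₀` on the unit ball are means of points of the compact set `O`, so they lie
    -- in its closed convex hull, which is compact.
    let O : Set H := (fun q : ℂ × G => q.1 • U q.2 v) '' (Metric.closedBall 0 ‖v‖ ×ˢ Set.univ)
    have hO : IsCompact O := ((isCompact_closedBall _ _).prod isCompact_univ).image
      (continuous_fst.smul ((hcont v).comp continuous_snd))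
    refine (isCompactOperator_iff_exists_mem_nhds_image_subset_compact _).2
      ⟨Metric.closedBall 0 1, Metric.closedBall_mem_nhds _ one_pos, closure (convexHull ℝ O), ?_, ?_⟩
    · exact isCompact_iff_totallyBounded_isComplete.2
        ⟨(totallyBounded_convexHull.2 hO.totallyBounded).closure, isClosed_closure.isComplete⟩
    · rintro _ ⟨w, hw, rfl⟩
      refine (convex_convexHull ℝ O).closure.integral_mem isClosed_closure
        (Eventually.of_forall fun t => subset_closure (subset_convexHull ℝ O
          ⟨(⟪U t v, w⟫, t), ⟨?_, trivial⟩, rfl⟩)) (hint w)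
      rw [mem_closedBall_zero_iff] at hw ⊢
      exact (hbd w t).trans (mul_le_of_le_one_right (norm_nonneg _) hw)
  exact ⟨ContinuousLinearMap.mkOfIsCompactOperator hcomp, hT₀, hcomp⟩

/-- For a strongly continuous unitary representation of a compact abelian group, an element that
acts trivially on every common eigenvector acts trivially. -/
lemma apply_eq_of_forall_eigenvector {G : Type*} [AddCommGroup G] [TopologicalSpace G]
    [IsTopologicalAddGroup G] [CompactSpace G] [MeasurableSpace G] [BorelSpace G] (μ : Measure G) [IsProbabilityMeasure μ]
    [μ.IsAddHaarMeasure] (U : G → H →ₗᵢ[ℂ] H)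
    (hadd : ∀ s t x, U (s + t) x = U s (U t x)) (h0 : ∀ x, U 0 x = x)
    (hcont : ∀ x, Continuous fun t => U t x) (a : G)
    (ha : ∀ e : H, e ≠ 0 → (∀ t, ∃ c : ℂ, U t e = c • e) → U a e = e) (x : H) : U a x = x := by
  set W : Submodule ℂ H := LinearMap.ker ((U a).toLinearMap - LinearMap.id) with hWdef
  have hW : ∀ x, x ∈ W ↔ U a x = x := fun x => by simp [hWdef, sub_eq_zero]
  have hWc : IsClosed (W : Set H) := by
    have : (W : Set H) = {x | U a x = x} := Set.ext hW
    rw [this]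
    exact isClosed_eq (U a).continuous continuous_id
  have hcomm : ∀ s t x, U s (U t x) = U t (U s x) := fun s t x => by
    rw [← hadd, add_comm, hadd]
  have hadj : ∀ t x y, ⟪U t x, y⟫ = ⟪x, U (-t) y⟫ := fun t x y => by
    rw [← (U (-t)).inner_map_map, ← hadd, neg_add_cancel, h0]
  rw [← hW]
  have : CompleteSpace W := hWc.completeSpace_coe
  suffices hbot : Wᗮ = ⊥ by
    rw [(Submodule.orthogonal_eq_bot_iff).1 hbot]; trivial
  by_contra hne
  -- The averaged operator `T` of `v` is compact, symmetric, nonzero, commutes with `U` and has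
  -- range in `Wᗮ`. An eigenspace for a nonzero eigenvalue is finite-dimensional and contained in
  -- `Wᗮ`; it contains a common eigenvector, which by `ha` also lies in `W`.
  obtain ⟨v, hv, hv0⟩ := Wᗮ.ne_bot_iff.1 hne
  obtain ⟨T, hT, hTc⟩ := exists_averaged_operator μ U hcont v
  have hint : ∀ w, Integrable (fun t => ⟪U t v, w⟫ • U t v) μ := fun w =>
    (((hcont v).inner continuous_const).smul (hcont v)).integrable_of_hasCompactSupport
      (HasCompactSupport.of_compactSpace _)
  have hTi : ∀ w y, ⟪y, T w⟫ = ∫ t, ⟪U t v, w⟫ * ⟪y, U t v⟫ ∂μ := fun w y => by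
    rw [hT, ← integral_inner (hint w)]
    simp only [inner_smul_right]
  have hsymm : T.IsSymmetric := by
    intro w y
    change ⟪T w, y⟫ = ⟪w, T y⟫
    rw [← inner_conj_symm, hTi, hTi, ← integral_conj]
    refine integral_congr_ae (Eventually.of_forall fun t => ?_)
    simp [mul_comm]
  have hTU : ∀ s w, T (U s w) = U s (T w) := by
    intro s w
    rw [hT, hT, ← integral_add_left_eq_self _ s]
    refine Eq.trans ?_ ((U s).toContinuousLinearMap.integral_comp_comm (hint w))
    refine integral_congr_ae (Eventually.of_forall fun t => ?_)
    simp [hadd]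
  -- `⟪v, T v⟫` is the integral of the continuous function `‖⟪U t v, v⟫‖ ^ 2`, which is positive at
  -- `t = 0`.
  have hTv : T v ≠ 0 := by
    intro h
    have h1 := hTi v v
    rw [h, inner_zero_right] at h1
    have h2 : ∫ t, ‖⟪U t v, v⟫‖ ^ 2 ∂μ = 0 := by
      rw [← Complex.ofReal_inj, ← integral_complex_ofReal, Complex.ofReal_zero, h1]
      refine integral_congr_ae (Eventually.of_forall fun t => ?_)
      simp only
      rw [← inner_conj_symm v, Complex.mul_conj, Complex.normSq_eq_norm_sq]
    have hc2 : Continuous fun t => ‖⟪U t v, v⟫‖ ^ 2 :=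
      (((hcont v).inner continuous_const).norm).pow 2
    have h3 := (hc2.integral_pos_of_hasCompactSupport_nonneg_nonzero (μ := μ) (x := 0)
      (HasCompactSupport.of_compactSpace _) (fun t => by positivity) (by simpa [h0] using hv0))
    exact h3.ne' h2
  -- `W` is stable under every `U t`, and the adjoint of `U t` is `U (-t)`; so `Wᗮ` contains the
  -- whole orbit of `v`.
  have hTW : ∀ w, T w ∈ Wᗮ := by
    intro w
    rw [Submodule.mem_orthogonal]
    intro y hy
    rw [hTi]
    refine integral_eq_zero_of_ae (Eventually.of_forall fun t => ?_)
    have : ⟪y, U t v⟫ = 0 := by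
      have h1 := hadj (-t) y v
      rw [neg_neg] at h1
      rw [← h1]
      refine (Submodule.mem_orthogonal _ _).1 hv _ ((hW _).2 ?_)
      rw [hcomm, (hW y).1 hy]
    simp [this]
  have hTne : T ≠ 0 := fun h => hTv (by simp [h])
  have := (not_congr (T.eq_zero_of_forall_hasEigenvalue_eq_zero hTc hsymm)).2 hTne
  push Not at this
  obtain ⟨c, hc, hc0⟩ := this
  have := T.finite_dimensional_eigenspace hTc c hc0
  obtain ⟨e, heE, he0, he⟩ := exists_common_eigenvector (fun t => (U t).toLinearMap) hcomm
    (Module.End.eigenspace (T : H →ₗ[ℂ] H) c) hc (by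
      intro t x hx
      rw [Module.End.mem_eigenspace_iff] at hx ⊢
      change T (U t x) = c • U t x
      rw [hTU, show T x = c • x from hx, map_smul])
  have hTe : T e = c • e := Module.End.mem_eigenspace_iff.1 heE
  have heW : e ∈ Wᗮ := by
    have : e = c⁻¹ • T e := by rw [hTe, smul_smul, inv_mul_cancel₀ hc0, one_smul]
    rw [this]
    exact Submodule.smul_mem _ _ (hTW e)
  have := (Submodule.mem_orthogonal _ _).1 heW e ((hW e).2 (ha e he0 he))
  exact he0 (inner_self_eq_zero.1 this)

end PeterWeyl

/-! ### Characters separate the points of a compact abelian group -/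

section Characters

open MeasureTheory

/-- A common eigenvector of a strongly continuous unitary representation defines a character. -/
lemma exists_character_of_eigenvector {G H : Type*} [AddCommGroup G]
    [TopologicalSpace G] [NormedAddCommGroup H] [InnerProductSpace ℂ H]
    (U : G → H →ₗᵢ[ℂ] H) (hadd : ∀ s t x, U (s + t) x = U s (U t x))
    (hcont : ∀ x, Continuous fun t => U t x) {e : H} (he : e ≠ 0)
    (h : ∀ t, ∃ c : ℂ, U t e = c • e) :
    ∃ χ : AddChar G Circle, Continuous χ ∧ ∀ t, U t e = (χ t : ℂ) • e := by
  choose c hc using h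
  have hn : ∀ t, ‖c t‖ = 1 := fun t => by
    have := congrArg norm (hc t)
    rw [LinearIsometry.norm_map, norm_smul] at this
    exact (mul_eq_right₀ (norm_ne_zero_iff.2 he)).1 this.symm
  have hmul : ∀ s t, c (s + t) = c s * c t := fun s t => by
    refine smul_left_injective ℂ he ?_
    simp only
    rw [← hc, hadd, hc t, map_smul, hc s, smul_smul, mul_comm]
  have hcc : Continuous c := by
    have : c = fun t => inner ℂ e (U t e) / inner ℂ e e := by
      funext t
      rw [hc, inner_smul_right, mul_div_cancel_right₀ _ (inner_self_ne_zero.2 he)]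
    rw [this]
    exact (continuous_const.inner (hcont e)).div_const _
  have hc0 : c 0 = 1 := by
    have h1 := hmul 0 0
    rw [add_zero] at h1
    exact (mul_eq_left₀ (norm_ne_zero_iff.1 (by simp [hn]))).1 h1.symm
  exact ⟨{ toFun := fun t => ⟨c t, mem_sphere_zero_iff_norm.2 (hn t)⟩
           map_zero_eq_one' := Subtype.ext hc0
           map_add_eq_mul' := fun s t => Subtype.ext (hmul s t) },
    hcc.subtype_mk fun t => mem_sphere_zero_iff_norm.2 (hn t), fun t => hc t⟩

variable {G : Type*} [AddCommGroup G] [TopologicalSpace G] [IsTopologicalAddGroup G]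
  [CompactSpace G]

/-- In the translation representation on `L²`, the group acts on a common eigenvector through a
character. If all characters are trivial at `a`, translation by `a` is therefore the identity on
`L²`, and continuous functions with the same class in `L²` coincide. -/
lemma apply_eq_of_forall_character [MeasurableSpace G] [BorelSpace G] (μ : Measure G)
    [IsProbabilityMeasure μ] [μ.IsAddHaarMeasure] [μ.InnerRegularCompactLTTop] {a : G}
    (hall : ∀ χ : AddChar G Circle, Continuous χ → χ a = 1) (F : C(G, ℂ)) : F a = F 0 := by
  obtain ⟨U, hU⟩ : ∃ U : G → Lp ℂ 2 μ →ₗᵢ[ℂ] Lp ℂ 2 μ, ∀ t x,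
      U t x = Lp.compMeasurePreserving (t + ·) (measurePreserving_add_left μ t) x :=
    ⟨fun t => Lp.compMeasurePreservingₗᵢ ℂ (t + ·) (measurePreserving_add_left μ t),
      fun t x => rfl⟩
  have hadd : ∀ s t x, U (s + t) x = U s (U t x) := fun s t x => by
    have := Lp.compMeasurePreserving_comp_apply x (measurePreserving_add_left μ t)
      (measurePreserving_add_left μ s)
    rw [hU, hU, hU, ← this]
    congr 1
    congr 1
    funext y
    simp [add_comm, add_left_comm]
  have hcont : ∀ x, Continuous fun t => U t x := fun x => by
    simp only [hU]
    exact (continuous_const (y := x)).compMeasurePreservingLp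
      (g := fun t => (ContinuousMap.mk (fun q : G × G => q.1 + q.2) continuous_add).curry t)
      (ContinuousMap.continuous _) (fun t => measurePreserving_add_left μ t) (by simp)
  -- `U 0` is idempotent and injective.
  have h0 : ∀ x, U 0 x = x := fun x => by
    have h1 := hadd 0 0 x
    rw [add_zero] at h1
    exact (LinearIsometry.injective _ h1).symm
  have hF := apply_eq_of_forall_eigenvector μ U hadd h0 hcont a (by
    intro e he h
    obtain ⟨χ, hχ, hχe⟩ := exists_character_of_eigenvector U hadd hcont he h
    rw [hχe, hall χ hχ]
    simp) (ContinuousMap.toLp 2 μ ℂ F)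
  let F' : C(G, ℂ) := F.comp ⟨(a + ·), continuous_const.add continuous_id⟩
  have hFa : U a (ContinuousMap.toLp 2 μ ℂ F) = ContinuousMap.toLp 2 μ ℂ F' := by
    rw [hU]
    refine Lp.ext ((Lp.coeFn_compMeasurePreserving _ _).trans ?_)
    refine EventuallyEq.trans ?_ (ContinuousMap.coeFn_toLp μ F').symm
    exact (measurePreserving_add_left μ a).quasiMeasurePreserving.ae_eq_comp
      (ContinuousMap.coeFn_toLp μ F)
  rw [hFa] at hF
  have := DFunLike.congr_fun (ContinuousMap.toLp_injective μ hF) 0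
  simpa [F'] using this

/-- The characters of a compact abelian group separate its points. -/
theorem exists_character_apply_ne_one [T2Space G] {a : G} (ha : a ≠ 0) :
    ∃ χ : AddChar G Circle, Continuous χ ∧ χ a ≠ 1 := by
  borelize G
  have : IsProbabilityMeasure (Measure.addHaarMeasure (⊤ : TopologicalSpace.PositiveCompacts G)) :=
    ⟨by simpa using Measure.addHaarMeasure_self (K₀ := (⊤ : TopologicalSpace.PositiveCompacts G))⟩
  by_contra! hall
  obtain ⟨f, hf0, hf1, -⟩ := exists_continuous_zero_one_of_isClosed
    (isClosed_singleton (x := (0 : G))) (isClosed_singleton (x := a)) (by simpa using ha.symm)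
  have := apply_eq_of_forall_character
    (Measure.addHaarMeasure (⊤ : TopologicalSpace.PositiveCompacts G)) hall
    ⟨fun x => (f x : ℂ), Complex.continuous_ofReal.comp f.continuous⟩
  have e0 : f 0 = 0 := hf0 rfl
  have e1 : f a = 1 := hf1 rfl
  simp [e0, e1] at this

end Characters

/-! ### Continuous injective endomorphisms of the circle -/

section CircleHom

lemma Circle.im_eq_zero_iff (z : Circle) : (z : ℂ).im = 0 ↔ z ^ 2 = 1 := by
  have h := Circle.normSq_coe z
  rw [Complex.normSq_apply] at h
  rw [← Circle.coe_inj, Circle.coe_pow, Circle.coe_one, pow_two, Complex.ext_iff,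
    Complex.mul_re, Complex.mul_im, Complex.one_re, Complex.one_im]
  constructor
  · intro h0
    rw [h0] at h ⊢
    constructor <;> linarith
  · rintro ⟨h1, -⟩
    have : (z : ℂ).im * (z : ℂ).im = 0 := by linarith
    exact mul_self_eq_zero.1 this

lemma Circle.coe_eq_or_eq_neg_of_sq_eq {z w : Circle} (h : z ^ 2 = w ^ 2) :
    (z : ℂ) = w ∨ (z : ℂ) = -w :=
  sq_eq_sq_iff_eq_or_eq_neg.1 (by simpa using congrArg ((↑) : Circle → ℂ) h)

/-- The only continuous injective endomorphisms of the circle group are the identity and the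
inversion. -/
lemma Circle.monoidHom_eq (φ : Circle →* Circle) (hφ : Continuous φ)
    (hinj : Function.Injective φ) : (∀ z, φ z = z) ∨ ∀ z, φ z = z⁻¹ := by
  -- it suffices to treat the case where `φ i` lies on the upper half of the circle
  have main : ∀ φ : Circle →* Circle, Continuous φ → Function.Injective φ →
      0 < ((φ (Circle.exp (Real.pi / 2)) : Circle) : ℂ).im → ∀ z, φ z = z := by
    intro φ hφ hinj hpos
    have hexp : Continuous fun t : ℝ => ((φ (Circle.exp t) : Circle) : ℂ).im :=
      Complex.continuous_im.comp (continuous_subtype_val.comp (hφ.comp Circle.exp.continuous))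
    -- A point of the circle is real iff its square is `1`, a property that the injective `φ`
    -- reflects. By connectedness `φ` then maps the open upper half-circle into itself.
    have hne : ∀ t ∈ Set.Ioo 0 Real.pi, ((φ (Circle.exp t) : Circle) : ℂ).im ≠ 0 := by
      intro t ht h
      rw [Circle.im_eq_zero_iff, ← map_pow, map_eq_one_iff φ hinj, ← Circle.im_eq_zero_iff] at h
      rw [Circle.coe_exp, Complex.exp_ofReal_mul_I_im] at h
      exact (Real.sin_pos_of_mem_Ioo ht).ne' h
    have hup : ∀ t ∈ Set.Ioo 0 Real.pi, 0 < ((φ (Circle.exp t) : Circle) : ℂ).im := by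
      intro t ht
      by_contra! hle
      obtain ⟨s, hs, hs0⟩ := (isPreconnected_Ioo (a := (0 : ℝ)) (b := Real.pi)).intermediate_value
        ht (b := Real.pi / 2) ⟨by positivity, by linarith [Real.pi_pos]⟩ hexp.continuousOn ⟨hle, hpos.le⟩
      exact hne s hs hs0
    -- For `k = 0`, `-1` is the only element of order two. Afterwards the image is one of two
    -- opposite square roots, and the sign of the imaginary part selects the right one.
    have hdy : ∀ k : ℕ, φ (Circle.exp (Real.pi / 2 ^ k)) = Circle.exp (Real.pi / 2 ^ k) := by
      intro k
      induction k with
      | zero =>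
        have hne1 : ∀ z : Circle, z ≠ 1 → z ^ 2 = 1 → (z : ℂ) = -1 := fun z h1 h2 =>
          (Circle.coe_eq_or_eq_neg_of_sq_eq (h2.trans (one_pow 2).symm)).resolve_left
            fun h => h1 (Circle.ext h)
        have hpi : (Circle.exp Real.pi) ^ 2 = 1 := by
          rw [pow_two, ← Circle.exp_add, ← two_mul, Circle.exp_two_pi]
        have hpi1 : Circle.exp Real.pi ≠ 1 := by
          intro h
          have := congrArg ((↑) : Circle → ℂ) h
          norm_num [Circle.coe_exp] at this
        rw [pow_zero, div_one]
        refine Circle.ext ?_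
        rw [hne1 _ hpi1 hpi, hne1 _ (by rwa [Ne, map_eq_one_iff φ hinj])
          (by rw [← map_pow, hpi, map_one])]
      | succ k ih =>
        have hmem : Real.pi / 2 ^ (k + 1) ∈ Set.Ioo 0 Real.pi :=
          ⟨by positivity, div_lt_self Real.pi_pos (one_lt_pow₀ one_lt_two k.succ_ne_zero)⟩
        have hsq : Circle.exp (Real.pi / 2 ^ (k + 1)) ^ 2 = Circle.exp (Real.pi / 2 ^ k) := by
          rw [pow_two, ← Circle.exp_add]
          congr 1
          field_simp
          ring
        refine Circle.ext ((Circle.coe_eq_or_eq_neg_of_sq_eq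
          (by rw [← map_pow, hsq, ih])).resolve_right fun h => ?_)
        have h1 := hup _ hmem
        rw [h, Complex.neg_im, Circle.coe_exp, Complex.exp_ofReal_mul_I_im] at h1
        linarith [Real.sin_pos_of_mem_Ioo hmem]
    -- A closed subgroup of `ℝ` that contains all `π / 2 ^ k` is dense, hence everything.
    let S : AddSubgroup ℝ :=
      { carrier := {t | φ (Circle.exp t) = Circle.exp t}
        zero_mem' := by simp
        add_mem' := fun {s t} hs ht => by
          simp only [Set.mem_ofPred_eq, Circle.exp_add, map_mul] at hs ht ⊢
          rw [hs, ht]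
        neg_mem' := fun {s} hs => by
          simp only [Set.mem_ofPred_eq, Circle.exp_neg, map_inv] at hs ⊢
          rw [hs] }
    have hS : Dense (S : Set ℝ) := by
      refine AddSubgroup.dense_of_not_isolated_zero S fun ε hε => ?_
      obtain ⟨k, hk⟩ := exists_pow_lt_of_lt_one (div_pos hε Real.pi_pos) (one_half_lt_one (α := ℝ))
      refine ⟨Real.pi / 2 ^ k, hdy k, by positivity, ?_⟩
      rw [lt_div_iff₀ Real.pi_pos] at hk
      simpa [div_eq_inv_mul] using hk
    have hSc : IsClosed (S : Set ℝ) :=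
      isClosed_eq (hφ.comp Circle.exp.continuous) Circle.exp.continuous
    intro z
    have : Complex.arg z ∈ (S : Set ℝ) := by rw [← hSc.closure_eq, hS.closure_eq]; trivial
    have h : φ (Circle.exp (Complex.arg z)) = Circle.exp (Complex.arg z) := this
    rwa [Circle.exp_arg] at h
  have hI : ((φ (Circle.exp (Real.pi / 2)) : Circle) : ℂ).im ≠ 0 := by
    intro h
    rw [Circle.im_eq_zero_iff, ← map_pow, map_eq_one_iff φ hinj, ← Circle.im_eq_zero_iff,
      Circle.coe_exp, Complex.exp_ofReal_mul_I_im, Real.sin_pi_div_two] at h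
    exact one_ne_zero h
  rcases hI.lt_or_gt with h | h
  · right
    intro z
    have := main (invMonoidHom.comp φ) (continuous_inv.comp hφ) (inv_injective.comp hinj) ?_ z
    · exact inv_eq_iff_eq_inv.1 this
    · simpa [Circle.coe_inv_eq_conj] using h
  · exact Or.inl (main φ hφ hinj h)

end CircleHom

/-! ### Scalar automorphisms and characters -/

section CompactScalar

variable {K : Type*} [AddCommGroup K] [TopologicalSpace K]

/-- A continuous character of a compact group is surjective or has finite order. -/
lemma surjective_or_pow_eq_one [CompactSpace K] {χ : AddChar K Circle} (hχ : Continuous χ) :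
    Function.Surjective χ ∨ ∃ n : ℕ, n ≠ 0 ∧ ∀ x, χ x ^ n = 1 := by
  -- The preimage of the image of `χ` in `ℝ` is a closed subgroup containing `2π`. It is `ℝ`, or it
  -- is generated by some `a` with `n • a = 2π`, and then `χ` takes values in the roots of unity of
  -- order dividing `n`.
  let S : AddSubgroup ℝ :=
    { carrier := {t | Circle.exp t ∈ Set.range χ}
      zero_mem' := ⟨0, by simp⟩
      add_mem' := by
        rintro s t ⟨x, hx⟩ ⟨y, hy⟩
        exact ⟨x + y, by rw [AddChar.map_add_eq_mul, hx, hy, Circle.exp_add]⟩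
      neg_mem' := by
        rintro s ⟨x, hx⟩
        exact ⟨-x, by rw [AddChar.map_neg_eq_inv, hx, Circle.exp_neg]⟩ }
  have hSc : IsClosed (S : Set ℝ) := (isCompact_range hχ).isClosed.preimage Circle.exp.continuous
  rcases AddSubgroup.dense_or_cyclic S with hd | ⟨a, ha⟩
  · left
    intro z
    have : Complex.arg z ∈ (S : Set ℝ) := by rw [← hSc.closure_eq, hd.closure_eq]; trivial
    obtain ⟨x, hx⟩ := this
    exact ⟨x, by rw [hx, Circle.exp_arg]⟩
  · right
    have h2 : 2 * Real.pi ∈ S := ⟨0, by simp⟩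
    rw [ha, AddSubgroup.mem_closure_singleton] at h2
    obtain ⟨n, hn⟩ := h2
    have hn0 : n ≠ 0 := by
      rintro rfl
      rw [zero_smul] at hn
      linarith [Real.pi_pos]
    have ha1 : ∀ k : ℤ, Circle.exp (k • a) ^ n = 1 := fun k => by
      rw [← Circle.exp_zsmul, smul_smul, mul_comm, mul_smul, hn, Circle.exp_zsmul,
        Circle.exp_two_pi, one_zpow]
    have hall : ∀ x, χ x ^ n = 1 := fun x => by
      have : Complex.arg (χ x) ∈ S := ⟨x, by rw [Circle.exp_arg]⟩
      rw [ha, AddSubgroup.mem_closure_singleton] at this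
      obtain ⟨k, hk⟩ := this
      rw [← Circle.exp_arg (χ x), ← hk, ha1]
    refine ⟨n.natAbs, by simpa using hn0, fun x => ?_⟩
    rcases Int.natAbs_eq n with h | h
    · rw [← zpow_natCast, ← h, hall]
    · rw [← zpow_natCast, ← inv_inj, ← zpow_neg, ← h, hall, inv_one]

variable [CompactSpace K]

/-- `α` preserves the closed subgroup `ker χ`, so it induces an injective endomorphism of the circle
`K / ker χ`, continuous because `χ` is a quotient map. `Circle.monoidHom_eq` applies. -/
lemma SAut.character_comp_of_surjective (α : SAut K) {χ : AddChar K Circle} (hχ : Continuous χ)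
    (hs : Function.Surjective χ) :
    (∀ x, χ ((α : K ≃L[ℤ] K) x) = χ x) ∨ ∀ x, χ ((α : K ≃L[ℤ] K) x) = (χ x)⁻¹ := by
  let N : AddSubgroup K :=
    { carrier := {x | χ x = 1}
      zero_mem' := by simp
      add_mem' := fun {x y} hx hy => by
        simp only [Set.mem_ofPred_eq, AddChar.map_add_eq_mul] at hx hy ⊢
        rw [hx, hy, one_mul]
      neg_mem' := fun {x} hx => by
        simp only [Set.mem_ofPred_eq, AddChar.map_neg_eq_inv] at hx ⊢
        rw [hx, inv_one] }
  have hN : IsClosed (N : Set K) := isClosed_eq hχ continuous_const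
  have hiff : ∀ x y, χ ((α : K ≃L[ℤ] K) x) = χ ((α : K ≃L[ℤ] K) y) ↔ χ x = χ y := by
    intro x y
    have h := SAut.apply_mem_iff α hN (x := x - y)
    change χ _ = 1 ↔ χ _ = 1 at h
    rwa [map_sub, AddChar.map_sub_eq_div, AddChar.map_sub_eq_div, div_eq_one, div_eq_one] at h
  choose r hr using hs
  have hr' : ∀ x, χ ((α : K ≃L[ℤ] K) (r (χ x))) = χ ((α : K ≃L[ℤ] K) x) := fun x =>
    (hiff _ _).2 (hr _)
  let φ : Circle →* Circle := MonoidHom.mk' (fun z => χ ((α : K ≃L[ℤ] K) (r z))) fun z w => by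
    rw [← AddChar.map_add_eq_mul, ← map_add, hiff, AddChar.map_add_eq_mul, hr, hr, hr]
  have hφ : ∀ x, φ (χ x) = χ ((α : K ≃L[ℤ] K) x) := hr'
  have hq : Topology.IsQuotientMap χ := hχ.isClosedMap.isQuotientMap hχ fun z => ⟨r z, hr z⟩
  have hc : Continuous φ := by
    rw [hq.continuous_iff]
    have : (φ ∘ χ) = fun x => χ ((α : K ≃L[ℤ] K) x) := funext hφ
    rw [this]
    exact hχ.comp (α : K ≃L[ℤ] K).continuous
  have hinj : Function.Injective φ := by
    intro z w h
    rw [← hr z, ← hr w] at h ⊢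
    rw [hφ, hφ, hiff] at h
    exact h
  rcases Circle.monoidHom_eq φ hc hinj with h | h
  · exact Or.inl fun x => by rw [← hφ, h]
  · exact Or.inr fun x => by rw [← hφ, h]

end CompactScalar

/-! ### Restriction to closed subgroups -/

section Restrict

variable {A : Type*} [AddCommGroup A] [TopologicalSpace A]

lemma SAut.symm_apply_mem (α : SAut A) {H : AddSubgroup A} (hH : IsClosed (H : Set A)) {x : A}
    (hx : x ∈ H) : (α : A ≃L[ℤ] A).symm x ∈ H :=
  SAut.apply_mem α⁻¹ hH hx

/-- The restriction of scalar automorphisms to a closed subgroup. -/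
def SAut.restrict (H : AddSubgroup A) (hH : IsClosed (H : Set A)) : SAut A →* SAut H where
  toFun α :=
    ⟨{ toFun := fun x => ⟨(α : A ≃L[ℤ] A) x, SAut.apply_mem α hH x.2⟩
       map_add' := fun x y => Subtype.ext (map_add (α : A ≃L[ℤ] A) (x : A) y)
       map_smul' := fun n x => Subtype.ext (map_smul (α : A ≃L[ℤ] A) n (x : A))
       invFun := fun x => ⟨(α : A ≃L[ℤ] A).symm x, SAut.symm_apply_mem α hH x.2⟩
       left_inv := fun x => Subtype.ext ((α : A ≃L[ℤ] A).symm_apply_apply x)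
       right_inv := fun x => Subtype.ext ((α : A ≃L[ℤ] A).apply_symm_apply x)
       continuous_toFun := ((α : A ≃L[ℤ] A).continuous.comp continuous_subtype_val).subtype_mk _
       continuous_invFun :=
        ((α : A ≃L[ℤ] A).symm.continuous.comp continuous_subtype_val).subtype_mk _ }, by
      intro H' hH'
      have hcl : IsClosed ((H'.map H.subtype : AddSubgroup A) : Set A) :=
        hH.isClosedEmbedding_subtypeVal.isClosedMap _ hH'
      ext x
      constructor
      · rintro ⟨y, hy, rfl⟩
        obtain ⟨z, hz, hzy⟩ := SAut.apply_mem α hcl ⟨y, hy, rfl⟩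
        have : z = ⟨(α : A ≃L[ℤ] A) y, SAut.apply_mem α hH y.2⟩ := Subtype.ext hzy
        rw [this] at hz
        exact hz
      · intro hx
        obtain ⟨z, hz, hzx⟩ := SAut.symm_apply_mem α hcl ⟨x, hx, rfl⟩
        refine ⟨z, hz, Subtype.ext ?_⟩
        change (α : A ≃L[ℤ] A) (z : A) = x
        rw [show (z : A) = (α : A ≃L[ℤ] A).symm x from hzx]
        exact (α : A ≃L[ℤ] A).apply_symm_apply x⟩
  map_one' := rfl
  map_mul' _ _ := rfl

@[simp] lemma SAut.coe_restrict_apply (H : AddSubgroup A) (hH : IsClosed (H : Set A)) (α : SAut A)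
    (x : H) : (((SAut.restrict H hH α : SAut H) : H ≃L[ℤ] H) x : A) = (α : A ≃L[ℤ] A) x := rfl

end Restrict

/-! ### Compact groups that are not totally disconnected -/

section CompactScalar

lemma not_forall_pow_eq_one_of_surjective {K : Type*} [AddCommGroup K]
    {χ : AddChar K Circle} (hs : Function.Surjective χ)
    {n : ℕ} (hn : n ≠ 0) : ¬ ∀ x, χ x ^ n = 1 := by
  intro h
  obtain ⟨x, hx⟩ := hs (Circle.exp (Real.pi / n))
  have hn' : (n : ℝ) ≠ 0 := by exact_mod_cast hn
  have h1 := h x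
  rw [hx, ← Circle.exp_nsmul, nsmul_eq_mul, mul_div_cancel₀ _ hn'] at h1
  have := congrArg ((↑) : Circle → ℂ) h1
  norm_num [Circle.coe_exp] at this

variable {K : Type*} [AddCommGroup K] [TopologicalSpace K] [CompactSpace K]

/-- The product `χ * χ₀` ties the behaviour of `χ` to that of `χ₀`: a wrong sign on `χ` or on the
product would give `χ` or `χ₀` finite order although it is surjective. Characters of finite order
come first, because `χ * χ₀` may be one. -/
lemma SAut.character_comp_eq (α : SAut K) {χ₀ : AddChar K Circle} (hχ₀ : Continuous χ₀)
    (hs₀ : Function.Surjective χ₀) (h₀ : ∀ x, χ₀ ((α : K ≃L[ℤ] K) x) = χ₀ x)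
    {χ : AddChar K Circle} (hχ : Continuous χ) (x : K) : χ ((α : K ≃L[ℤ] K) x) = χ x := by
  have hfin : ∀ χ : AddChar K Circle, Continuous χ → ∀ n : ℕ, n ≠ 0 → (∀ x, χ x ^ n = 1) →
      ∀ x, χ ((α : K ≃L[ℤ] K) x) = χ x := by
    intro χ hχ n hn h x
    have hψ : Continuous (χ * χ₀) := hχ.mul hχ₀
    rcases surjective_or_pow_eq_one hψ with hs | ⟨m, hm, hm1⟩
    · rcases SAut.character_comp_of_surjective α hψ hs with e | e
      · have := e x
        rw [AddChar.mul_apply, AddChar.mul_apply, h₀] at this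
        exact mul_right_cancel this
      · refine absurd (fun y => ?_) (not_forall_pow_eq_one_of_surjective hs₀
          (n := 2 * n) (by omega))
        have h1 := congrArg (· ^ n) (e y)
        simp only [AddChar.mul_apply, h₀, inv_pow, mul_pow, h, one_mul] at h1
        rw [two_mul, pow_add]
        nth_rw 1 [h1]
        exact inv_mul_cancel _
    · refine absurd (fun y => ?_) (not_forall_pow_eq_one_of_surjective hs₀
          (n := n * m) (mul_ne_zero hn hm))
      have h1 := congrArg (· ^ n) (hm1 y)
      simp only [AddChar.mul_apply, mul_pow, one_pow] at h1
      rwa [pow_right_comm, h, one_pow, one_mul, ← pow_mul, mul_comm] at h1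
  rcases surjective_or_pow_eq_one hχ with hs | ⟨n, hn, h⟩
  swap
  · exact hfin χ hχ n hn h x
  rcases SAut.character_comp_of_surjective α hχ hs with e | e
  · exact e x
  have hψ : Continuous (χ * χ₀) := hχ.mul hχ₀
  rcases surjective_or_pow_eq_one hψ with hs' | ⟨n, hn, h⟩
  · rcases SAut.character_comp_of_surjective α hψ hs' with e' | e'
    · refine absurd (fun y => ?_) (not_forall_pow_eq_one_of_surjective hs two_ne_zero)
      have h1 := e' y
      rw [AddChar.mul_apply, AddChar.mul_apply, h₀, e, mul_left_inj] at h1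
      rw [pow_two]
      nth_rw 1 [← h1]
      exact inv_mul_cancel _
    · refine absurd (fun y => ?_) (not_forall_pow_eq_one_of_surjective hs₀ two_ne_zero)
      have h1 := e' y
      rw [AddChar.mul_apply, AddChar.mul_apply, h₀, e, mul_inv, mul_right_inj] at h1
      rw [pow_two]
      nth_rw 1 [h1]
      exact inv_mul_cancel _
  · have := hfin _ hψ n hn h x
    rw [AddChar.mul_apply, AddChar.mul_apply, h₀] at this
    exact mul_right_cancel this

variable [IsTopologicalAddGroup K] [T2Space K]

/-- A compact abelian group that is not totally disconnected has a character onto the circle. -/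
lemma exists_surjective_character (hK : ¬ TotallyDisconnectedSpace K) :
    ∃ χ : AddChar K Circle, Continuous χ ∧ Function.Surjective χ := by
  rw [totallyDisconnectedSpace_iff_connectedComponent_zero] at hK
  obtain ⟨a, ha, ha0⟩ : ∃ a ∈ connectedComponent (0 : K), a ≠ 0 := by
    by_contra! h
    exact hK (Set.eq_singleton_iff_unique_mem.2 ⟨mem_connectedComponent, h⟩)
  obtain ⟨χ, hχ, hχa⟩ := exists_character_apply_ne_one ha0
  refine ⟨χ, hχ, (surjective_or_pow_eq_one hχ).resolve_right ?_⟩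
  rintro ⟨n, hn, h⟩
  -- A character of finite order has finite image, so it is constant on the connected component of
  -- `0`, contrary to `χ a ≠ 1`.
  have hfin : {z : Circle | z ^ n = 1}.Finite := by
    refine ((Polynomial.nthRoots n (1 : ℂ)).toFinset.finite_toSet.preimage
      (f := fun z : Circle => (z : ℂ)) Circle.coe_injective.injOn).subset fun (z : Circle) hz => ?_
    have : (z : ℂ) ^ n = 1 := by
      rw [← Circle.coe_pow, show z ^ n = 1 from hz, Circle.coe_one]
    simpa [Polynomial.mem_nthRoots (Nat.pos_of_ne_zero hn)] using this
  have h1 := isPreconnected_connectedComponent.constant_of_mapsTo hfin.isDiscrete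
    hχ.continuousOn (fun x _ => h x) ha mem_connectedComponent
  exact hχa (by simpa using h1)

/-- After composition with `-id` if necessary, `α` fixes `χ₀`, hence every character, hence every
point. -/
lemma SAut.eq_one_or_eq_neg_of_compactSpace (hK : ¬ TotallyDisconnectedSpace K) (α : SAut K) :
    (∀ x, (α : K ≃L[ℤ] K) x = x) ∨ ∀ x, (α : K ≃L[ℤ] K) x = -x := by
  obtain ⟨χ₀, hχ₀, hs₀⟩ := exists_surjective_character hK
  have key : ∀ β : SAut K, (∀ x, χ₀ ((β : K ≃L[ℤ] K) x) = χ₀ x) → ∀ x, (β : K ≃L[ℤ] K) x = x := by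
    intro β hβ x
    by_contra hne
    obtain ⟨χ, hχ, h⟩ := exists_character_apply_ne_one (sub_ne_zero.2 hne)
    rw [AddChar.map_sub_eq_div, SAut.character_comp_eq β hχ₀ hs₀ hβ hχ, div_self'] at h
    exact h rfl
  rcases SAut.character_comp_of_surjective α hχ₀ hs₀ with h | h
  · exact Or.inl (key α h)
  · right
    intro x
    have := key (⟨_, neg_mem_SAut⟩ * α) (fun x => by
      change χ₀ (-((α : K ≃L[ℤ] K) x)) = χ₀ x
      rw [AddChar.map_neg_eq_inv, h, inv_inv]) x
    exact neg_eq_iff_eq_neg.1 this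

end CompactScalar

/-! ### Non-periodic groups -/

section NonPeriodic

variable {A : Type*} [AddCommGroup A] [TopologicalSpace A] [IsTopologicalAddGroup A]
  [LocallyCompactSpace A] [T2Space A]

/-- A compact open subgroup contains the connected component of `0`, so it is not totally
disconnected either, and the compact case determines `α` on it up to sign. -/
lemma SAut.eq_one_or_eq_neg_of_not_totallyDisconnectedSpace
    (hA : ∀ g : A, IsCompact ((AddSubgroup.zmultiples g).topologicalClosure : Set A))
    (hd : ¬ TotallyDisconnectedSpace A) (α : SAut A) :
    (α : A ≃L[ℤ] A) = 1 ∨ (α : A ≃L[ℤ] A) = ContinuousLinearEquiv.neg ℤ := by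
  refine eq_one_or_eq_neg_of_forall fun h => ?_
  obtain ⟨K, hK, hKo, hhK⟩ := exists_compact_open_addSubgroup hA (isCompact_singleton (x := h))
  have : CompactSpace K := isCompact_iff_compactSpace.1 hK
  have hKd : ¬ TotallyDisconnectedSpace K := by
    intro hKd
    refine hd (totallyDisconnectedSpace_iff_connectedComponent_zero.2 ?_)
    have hsub : connectedComponent (0 : A) ⊆ K :=
      isPreconnected_connectedComponent.subset_isClopen ⟨hK.isClosed, hKo⟩
        ⟨0, mem_connectedComponent, K.zero_mem⟩
    exact Set.eq_singleton_iff_unique_mem.2 ⟨mem_connectedComponent, fun x hx =>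
      (totallyDisconnectedSpace_subtype_iff.1 hKd) _ hsub isPreconnected_connectedComponent hx
        mem_connectedComponent⟩
  rcases SAut.eq_one_or_eq_neg_of_compactSpace hKd (SAut.restrict K hK.isClosed α) with e | e
  · exact Or.inl (congrArg Subtype.val (e ⟨h, hhK rfl⟩))
  · exact Or.inr (congrArg Subtype.val (e ⟨h, hhK rfl⟩))

theorem SAut.eq_of_not_isPeriodic (hA : ¬ IsPeriodic A) :
    (SAut A : Set (A ≃L[ℤ] A)) = {1, ContinuousLinearEquiv.neg ℤ} := by
  ext α
  constructor
  · intro hα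
    by_cases hc : ∀ g : A, IsCompact ((AddSubgroup.zmultiples g).topologicalClosure : Set A)
    · exact SAut.eq_one_or_eq_neg_of_not_totallyDisconnectedSpace hc
        (fun hd => hA ⟨inferInstance, hd, hc⟩) ⟨α, hα⟩
    · push Not at hc
      obtain ⟨g, hg⟩ := hc
      exact SAut.eq_one_or_eq_neg_of_not_isCompact ⟨α, hα⟩ hg
  · rintro (rfl | rfl)
    · exact (SAut A).one_mem
    · exact neg_mem_SAut

end NonPeriodic

section DenseScalars

/-! ### Modules over a topological ring in which the integers are dense -/

variable {S B : Type*} [CommRing S] [TopologicalSpace S] [AddCommGroup B] [TopologicalSpace B]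
  [Module S B] [ContinuousSMul S B]

lemma smul_mem_of_isClosed (hd : DenseRange (Int.cast : ℤ → S)) {H : AddSubgroup B}
    (hH : IsClosed (H : Set B)) (s : S) {x : B} (hx : x ∈ H) : s • x ∈ H := by
  refine hd.induction_on (p := fun s => s • x ∈ H) s
    (hH.preimage (continuous_id.smul continuous_const)) fun n => ?_
  rw [Int.cast_smul_eq_zsmul]
  exact H.zsmul_mem hx n

lemma map_smul_of_continuous [T2Space B] (hd : DenseRange (Int.cast : ℤ → S)) (f : B →+ B)
    (hf : Continuous f) (s : S) (x : B) : f (s • x) = s • f x := by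
  have hc : ∀ y : B, Continuous fun s : S => s • y := fun y => continuous_id.smul continuous_const
  refine congrFun (hd.equalizer (hf.comp (hc x)) (hc (f x)) ?_) s
  funext n
  simp only [Function.comp, Int.cast_smul_eq_zsmul, map_zsmul]

/-- The scalar automorphism given by multiplication by a unit. -/
def SAut.ofUnits (hd : DenseRange (Int.cast : ℤ → S)) : Sˣ →* SAut B where
  toFun u :=
    ⟨{ toFun := fun x => (u : S) • x
       map_add' := smul_add _
       map_smul' := fun n x => smul_comm _ _ _
       invFun := fun x => ((u⁻¹ : Sˣ) : S) • x
       left_inv := fun x => by simp [smul_smul]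
       right_inv := fun x => by simp [smul_smul]
       continuous_toFun := continuous_const.smul continuous_id
       continuous_invFun := continuous_const.smul continuous_id }, by
      intro H hH
      ext x
      constructor
      · rintro ⟨y, hy, rfl⟩
        exact smul_mem_of_isClosed hd hH _ hy
      · intro hx
        exact ⟨((u⁻¹ : Sˣ) : S) • x, smul_mem_of_isClosed hd hH _ hx, by simp [smul_smul]⟩⟩
  map_one' := Subtype.ext (ContinuousLinearEquiv.ext (funext fun x => one_smul S x))
  map_mul' u v := Subtype.ext (ContinuousLinearEquiv.ext (funext fun x => mul_smul (u : S) v x))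

@[simp] lemma SAut.ofUnits_apply (hd : DenseRange (Int.cast : ℤ → S)) (u : Sˣ) (x : B) :
    ((SAut.ofUnits hd u : SAut B) : B ≃L[ℤ] B) x = (u : S) • x := rfl

/-- Currying turns the joint continuity of the action, and of the action by inverses, into
continuity for the compact-open topology. -/
lemma SAut.continuous_ofUnits (hd : DenseRange (Int.cast : ℤ → S)) :
    Continuous (SAut.ofUnits hd : Sˣ → SAut B) := by
  refine continuous_induced_rng.2 (Continuous.prodMk ?_ ?_)
  · refine ContinuousMap.continuous_of_continuous_uncurry _ ?_
    exact (Units.continuous_val.comp continuous_fst).smul continuous_snd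
  · refine ContinuousMap.continuous_of_continuous_uncurry _ ?_
    exact (Units.continuous_coe_inv.comp continuous_fst).smul continuous_snd

/-- This makes continuous maps from compact unit groups to `SAut B` closed. -/
instance [T2Space B] : T2Space (SAut B) := by
  refine T2Space.of_injective_continuous (f := fun α : SAut B =>
    (((α : B ≃L[ℤ] B) : C(B, B)), (((α⁻¹ : SAut B) : B ≃L[ℤ] B) : C(B, B)))) ?_
    continuous_induced_dom
  intro α β h
  refine Subtype.ext (ContinuousLinearEquiv.ext (funext fun x => ?_))
  exact DFunLike.congr_fun (Prod.ext_iff.1 h).1 x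

end DenseScalars

/-! ### Linear maps that send each element to a multiple of itself -/

section Padic

variable {p : ℕ} [hp : Fact p.Prime] {M : Type*} [AddCommGroup M] [Module ℤ_[p] M]

/-- From `β b = t • b` and `β (a + b) = s • (a + b)` it follows that `(t - s) • b = s • a`. Both
sides vanish by disjointness, so `s` kills `a`, hence `b`. -/
lemma eq_zero_of_disjoint_span {β : M →ₗ[ℤ_[p]] M} (hβ : ∀ x, ∃ t : ℤ_[p], β x = t • x) {a b : M}
    (ha : β a = 0) (hab : ∀ t : ℤ_[p], t • a = 0 → t • b = 0)
    (hdis : ∀ t s : ℤ_[p], t • b = s • a → t • b = 0) : β b = 0 := by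
  obtain ⟨s, hs⟩ := hβ (a + b)
  obtain ⟨t, ht⟩ := hβ b
  rw [map_add, ha, zero_add, ht, smul_add] at hs
  have h1 : (t - s) • b = 0 := hdis _ s (by rw [sub_smul, hs, add_sub_cancel_right])
  have h2 : t • b = s • b := by rwa [sub_smul, sub_eq_zero] at h1
  have h3 : s • a = 0 := by rw [h2] at hs; exact left_eq_add.1 (hs.trans (add_comm _ _))
  rw [ht, h2, hab s h3]

/-- A linear map sending every element to a multiple of itself that vanishes at `a` also vanishes
at each element annihilated by the annihilator of `a`. -/
lemma eq_zero_of_annihilator_le {β : M →ₗ[ℤ_[p]] M} (hβ : ∀ x, ∃ t : ℤ_[p], β x = t • x) {a b : M}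
    (ha : β a = 0) (hab : ∀ t : ℤ_[p], t • a = 0 → t • b = 0) : β b = 0 := by
  obtain ⟨d, hd⟩ := (IsPrincipalIdealRing.principal
    ((Submodule.span ℤ_[p] {a}).comap (LinearMap.toSpanSingleton ℤ_[p] M b))).principal
  have hmem : ∀ t : ℤ_[p], (∃ s : ℤ_[p], s • a = t • b) ↔ d ∣ t := fun t => by
    rw [← Ideal.mem_span_singleton, ← Ideal.submodule_span_eq, ← hd, Submodule.mem_comap,
      Submodule.mem_span_singleton, LinearMap.toSpanSingleton_apply]
  obtain ⟨s, hs⟩ := (hmem d).2 dvd_rfl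
  -- Here `d` generates the ideal of scalars that carry `b` into the span of `a`. If `d • b = d • (k
  -- • a)`, the span of `b - k • a` meets that of `a` trivially. Otherwise `s` divides `d` properly:
  -- if `a` has zero annihilator, cancelling `s` gives the claim, and a nonzero annihilator is
  -- impossible.
  by_cases hk : ∃ k : ℤ_[p], s • a = (d * k) • a
  · obtain ⟨k, hk⟩ := hk
    have hb' : β (b - k • a) = 0 := by
      refine eq_zero_of_disjoint_span hβ ha (fun t ht => ?_) fun t r h => ?_
      · rw [smul_sub, hab t ht, smul_comm, ht, smul_zero, sub_zero]
      · obtain ⟨t', rfl⟩ := (hmem t).1 ⟨r + t * k, by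
          rw [add_smul, ← h, smul_sub, smul_smul, sub_add_cancel]⟩
        rw [smul_sub, smul_smul, mul_comm d t', mul_assoc, mul_smul, mul_smul t', ← hs, hk, sub_self]
    rwa [map_sub, map_smul, ha, smul_zero, sub_zero] at hb'
  · have hds : ¬ d ∣ s := fun ⟨k, h⟩ => hk ⟨k, by rw [h]⟩
    have hs0 : s ≠ 0 := fun h => hds (h ▸ dvd_zero d)
    obtain ⟨k, hk'⟩ := (ValuationRing.dvd_total d s).resolve_left hds
    obtain ⟨n, hn⟩ := (IsPrincipalIdealRing.principal
      (LinearMap.ker (LinearMap.toSpanSingleton ℤ_[p] M a))).principal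
    have hmemn : ∀ t : ℤ_[p], t • a = 0 ↔ n ∣ t := fun t => by
      rw [← Ideal.mem_span_singleton, ← Ideal.submodule_span_eq, ← hn, LinearMap.mem_ker,
        LinearMap.toSpanSingleton_apply]
    by_cases hn0 : n = 0
    · obtain ⟨t, ht⟩ := hβ b
      have h1 : (t * s) • a = 0 := by
        rw [mul_smul, hs, smul_comm, ← ht, ← map_smul, ← hs, map_smul, ha, smul_zero]
      rw [hmemn, hn0, zero_dvd_iff, mul_eq_zero] at h1
      rw [ht, h1.resolve_right hs0, zero_smul]
    · have hns : ¬ n ∣ s := fun h => hk ⟨0, by rw [(hmemn s).2 h, mul_zero, zero_smul]⟩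
      obtain ⟨m, hm⟩ := (ValuationRing.dvd_total n s).resolve_left hns
      have hp_dvd : ∀ x : ℤ_[p], ¬ IsUnit x → (p : ℤ_[p]) ∣ x := fun x hx =>
        (PadicInt.norm_lt_one_iff_dvd x).1 (PadicInt.not_isUnit_iff.1 hx)
      obtain ⟨m', rfl⟩ := hp_dvd m fun hu => hns (hm ▸ hu.mul_right_dvd.2 dvd_rfl)
      obtain ⟨k', rfl⟩ := hp_dvd k fun hu => hds (hk' ▸ hu.mul_right_dvd.2 dvd_rfl)
      -- With `n = s * (p * m')` and `d = s * (p * k')`, already `s * m'` kills `a`, since `m' * d =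
      -- k' * n` and `n` kills `b`. But `n` generates the annihilator of `a`.
      exfalso
      have h1 : (s * m') • a = 0 := by
        rw [mul_comm, mul_smul, hs, hk', smul_smul, show m' * (s * (p * k')) = k' * n by rw [hm]; ring,
          mul_smul, hab n ((hmemn n).2 dvd_rfl), smul_zero]
      obtain ⟨q, hq⟩ := (hmemn _).1 h1
      have hne : s * m' ≠ 0 := fun h => hn0 (by rw [hm, mul_left_comm, h, mul_zero])
      have h2 : s * m' * (p * q) = s * m' * 1 := by
        rw [mul_one]; nth_rw 2 [hq]; rw [hm]; ring
      have h3 := mul_left_cancel₀ hne h2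
      exact PadicInt.p_nonunit (p := p) (IsUnit.of_mul_eq_one _ h3)

end Padic

/-! ### Density of the integers and open ideals in the profinite integers -/

section ProfiniteInt

lemma exists_nat_sub_mem_span (I : Finset Nat.Primes) (k : Nat.Primes → ℕ) (z : ProfiniteInt) :
    ∃ n : ℕ, ∀ p ∈ I, z p - n ∈ (Ideal.span {((p : ℕ) : ℤ_[(p : ℕ)]) ^ k p} : Ideal _) := by
  have hpw : Set.Pairwise (I : Set Nat.Primes)
      (Function.onFun Nat.Coprime fun p : Nat.Primes => (p : ℕ) ^ k p) := fun p _ q _ hpq =>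
    Nat.Coprime.pow _ _ ((Nat.coprime_primes p.2 q.2).2 fun h => hpq (Subtype.ext h))
  obtain ⟨n, hn⟩ := Nat.chineseRemainderOfFinset (fun p : Nat.Primes => (z p).appr (k p))
    (fun p : Nat.Primes => (p : ℕ) ^ k p) I (fun p _ => pow_ne_zero _ p.2.ne_zero) hpw
  refine ⟨n, fun p hp => ?_⟩
  have h1 := PadicInt.appr_spec (k p) (z p)
  have h2 : (((z p).appr (k p) : ℤ_[(p : ℕ)]) - n) ∈
      (Ideal.span {((p : ℕ) : ℤ_[(p : ℕ)]) ^ k p} : Ideal _) := by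
    rw [Ideal.mem_span_singleton]
    have := (Nat.modEq_iff_dvd.1 (hn p hp))
    have h3 := (PadicInt.pow_p_dvd_int_iff (p := p) (k p)
      (((z p).appr (k p) : ℤ) - n)).2 (by exact_mod_cast this)
    simpa using h3
  simpa using Ideal.add_mem _ h1 h2

lemma denseRange_intCast_profiniteInt : DenseRange (Int.cast : ℤ → ProfiniteInt) := by
  intro z
  rw [mem_closure_iff_nhds]
  intro W hW
  rw [nhds_pi, Filter.mem_pi] at hW
  obtain ⟨I, hI, t, ht, hW⟩ := hW
  have hex : ∀ p : Nat.Primes, ∃ k : ℕ, ∀ x : ℤ_[(p : ℕ)],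
      x ∈ (Ideal.span {((p : ℕ) : ℤ_[(p : ℕ)]) ^ k} : Ideal _) → z p - x ∈ t p := fun p => by
    refine exists_span_pow_subset (W := (fun x => z p - x) ⁻¹' t p) ?_
    exact (continuous_const.sub continuous_id).continuousAt.preimage_mem_nhds
      (by simpa using ht p)
  choose k hk using hex
  obtain ⟨n, hn⟩ := exists_nat_sub_mem_span hI.toFinset k z
  refine ⟨(n : ℤ), hW fun p hp => ?_, n, rfl⟩
  simpa using hk p _ (hn p (hI.mem_toFinset.2 hp))

/-- Only finitely many coordinates carry a condition, as `N` is a unit in `ℤ_p` unless `p ∣ N`. -/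
lemma isOpen_setOf_forall_dvd {N : ℕ} (hN : N ≠ 0) :
    IsOpen {z : ProfiniteInt | ∀ p : Nat.Primes, (N : ℤ_[(p : ℕ)]) ∣ z p} := by
  have hfin : {p : Nat.Primes | (p : ℕ) ∣ N}.Finite :=
    (Set.finite_Iic N).preimage Subtype.val_injective.injOn |>.subset fun p hp =>
      Nat.le_of_dvd (Nat.pos_of_ne_zero hN) hp
  have hset : {z : ProfiniteInt | ∀ p : Nat.Primes, (N : ℤ_[(p : ℕ)]) ∣ z p}
      = {p : Nat.Primes | (p : ℕ) ∣ N}.pi fun p => {x | (N : ℤ_[(p : ℕ)]) ∣ x} := by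
    ext z
    refine ⟨fun h p _ => h p, fun h p => ?_⟩
    by_cases hp : (p : ℕ) ∣ N
    · exact h p hp
    · refine IsUnit.dvd (PadicInt.isUnit_iff.2 ?_)
      refine le_antisymm (PadicInt.norm_le_one _) (not_lt.1 fun hlt => hp ?_)
      have := (PadicInt.norm_int_lt_one_iff_dvd (p := p) (N : ℤ)).1 (by simpa using hlt)
      exact_mod_cast this
  rw [hset]
  refine isOpen_set_pi hfin fun p _ => ?_
  have hN' : (N : ℤ_[(p : ℕ)]) ≠ 0 := by exact_mod_cast hN
  have e : {x | (N : ℤ_[(p : ℕ)]) ∣ x} = ((Ideal.span {((p : ℕ) : ℤ_[(p : ℕ)]) ^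
      (N : ℤ_[(p : ℕ)]).valuation} : Ideal ℤ_[(p : ℕ)]) : Set ℤ_[(p : ℕ)]) := by
    ext x
    rw [SetLike.mem_coe, Ideal.mem_span_singleton, Set.mem_ofPred_eq]
    conv_lhs => rw [PadicInt.unitCoeff_spec hN']
    exact (PadicInt.unitCoeff hN').isUnit.mul_left_dvd
  rw [e]
  exact isOpen_span_pow _

lemma dvd_of_forall_dvd_padicInt {N : ℕ} {n : ℤ}
    (h : ∀ p : Nat.Primes, (N : ℤ_[(p : ℕ)]) ∣ (n : ℤ_[(p : ℕ)])) : (N : ℤ) ∣ n := by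
  rw [Int.natCast_dvd, Nat.dvd_iff_prime_pow_dvd_dvd]
  intro p k hp hk
  have := Fact.mk hp
  have h1 : (p : ℤ_[p]) ^ k ∣ (n : ℤ_[p]) := by
    refine dvd_trans ?_ (h ⟨p, hp⟩)
    exact_mod_cast Nat.cast_dvd_cast (α := ℤ_[p]) hk
  rw [PadicInt.pow_p_dvd_int_iff] at h1
  rw [← Int.natCast_dvd]
  exact_mod_cast h1

end ProfiniteInt

/-! ### Homomorphisms from the profinite integers to periodic groups -/

section Periodic

/-- A homomorphism from the integers to a compact group extends continuously to a topological ring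
in which the integers are dense, if it is continuous for the induced topology. -/
lemma exists_hom_of_denseRange {R M : Type*} [Ring R] [CharZero R] [UniformSpace R]
    [IsUniformAddGroup R] (hd : DenseRange (Int.cast : ℤ → R)) [AddCommGroup M]
    [TopologicalSpace M] [IsTopologicalAddGroup M] [CompactSpace M] [T2Space M] (g : M)
    (hg : ∀ W ∈ 𝓝 (0 : M), ∃ V ∈ 𝓝 (0 : R), ∀ n : ℤ, (n : R) ∈ V → n • g ∈ W) :
    ∃ φ : R →+ M, Continuous φ ∧ φ 1 = g := by
  let _ : UniformSpace M := IsTopologicalAddGroup.rightUniformSpace M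
  have : IsUniformAddGroup M := isUniformAddGroup_of_addCommGroup
  let S : AddSubgroup R := (Int.castAddHom R).range
  have inj : Function.Injective (Int.castAddHom R) := Int.cast_injective
  let eqv : ℤ ≃+ S := AddMonoidHom.ofInjective inj
  let f₀ : S →+ M := (zmultiplesHom M g).comp eqv.symm.toAddMonoidHom
  have f₀_apply : ∀ n : ℤ, f₀ (eqv n) = n • g := by
    intro n; simp [f₀]
  have f₀_cont : Continuous f₀ := by
    refine continuous_of_continuousAt_zero f₀ ?_
    rw [ContinuousAt, map_zero]
    intro W hW
    obtain ⟨V, hV, hVW⟩ := hg W hW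
    rw [mem_map]
    filter_upwards [continuous_subtype_val.continuousAt (x := (0 : S)) hV] with x hx
    obtain ⟨n, rfl⟩ := eqv.surjective x
    change f₀ (eqv n) ∈ W
    rw [f₀_apply]
    exact hVW n hx
  -- The compact group `M` is complete, so `f` extends from the dense subgroup `S`.
  let f : S →L[ℤ] M := ⟨f₀.toIntLinearMap, f₀_cont⟩
  let e : S →L[ℤ] R := ⟨S.subtype.toIntLinearMap, continuous_subtype_val⟩
  have hde : DenseRange e := by
    refine hd.mono ?_
    rintro _ ⟨n, rfl⟩
    exact ⟨eqv n, rfl⟩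
  have he : IsUniformInducing e := isUniformInducing_val _
  refine ⟨(f.extend e).toLinearMap.toAddMonoidHom, (f.extend e).continuous, ?_⟩
  have h1 : e (eqv 1) = 1 := by
    change ((1 : ℤ) : R) = 1
    simp
  change f.extend e 1 = g
  rw [← h1, ContinuousLinearMap.extend_eq _ hde he]
  change f₀ (eqv 1) = g
  rw [f₀_apply, one_zsmul]

/-- In a periodic group, every element is the image of `1` under a continuous homomorphism from
the profinite integers. -/
lemma IsPeriodic.exists_hom {A : Type*} [AddCommGroup A] [TopologicalSpace A]
    [IsTopologicalAddGroup A] [T2Space A] (hA : IsPeriodic A) (g : A) :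
    ∃ φ : ProfiniteInt →+ A, Continuous φ ∧ φ 1 = g := by
  let M := (AddSubgroup.zmultiples g).topologicalClosure
  have : CompactSpace M := isCompact_iff_compactSpace.1 (hA.compact_closure g)
  have := hA.totallyDisconnected
  let g' : M := ⟨g, AddSubgroup.le_topologicalClosure _ (AddSubgroup.mem_zmultiples g)⟩
  obtain ⟨p⟩ : Nonempty Nat.Primes := ⟨⟨2, Nat.prime_two⟩⟩
  have : CharZero ProfiniteInt := ⟨fun m n h => by
    have h2 : (m : ℤ_[(p : ℕ)]) = n := congrFun h p
    exact Nat.cast_injective h2⟩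
  obtain ⟨φ, hφ, h1⟩ := exists_hom_of_denseRange denseRange_intCast_profiniteInt g' (by
    intro W hW
    obtain ⟨W', ⟨h0, hc⟩, hW'⟩ := (nhds_basis_clopen (0 : M)).mem_iff.1 hW
    obtain ⟨U, hU⟩ := IsTopologicalAddGroup.exist_openAddSubgroup_sub_clopen_nhds_of_zero hc h0
    -- An open subgroup of the compact group `M` has finite index `N`, and `N • g'` lies in it; the
    -- multiples of `N` form the required neighbourhood.
    have hN : U.toAddSubgroup.index ≠ 0 := by
      have := AddSubgroup.quotient_finite_of_isOpen U.toAddSubgroup U.isOpen'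
      exact AddSubgroup.index_ne_zero_of_finite
    refine ⟨_, (isOpen_setOf_forall_dvd hN).mem_nhds (x := 0) (fun p => dvd_zero _),
      fun n hn => hW' (hU ?_)⟩
    obtain ⟨m, rfl⟩ : (U.toAddSubgroup.index : ℤ) ∣ n := dvd_of_forall_dvd_padicInt fun p => hn p
    rw [mul_comm, mul_zsmul]
    refine zsmul_mem ?_ m
    exact_mod_cast U.toAddSubgroup.nsmul_index_mem g')
  exact ⟨M.subtype.comp φ, continuous_subtype_val.comp hφ, congrArg Subtype.val h1⟩

/-- In a periodic group, the open subgroups form a neighbourhood basis of zero. -/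
lemma IsPeriodic.exists_isOpen_addSubgroup_subset {A : Type*} [AddCommGroup A] [TopologicalSpace A]
    [IsTopologicalAddGroup A] [T2Space A] (hA : IsPeriodic A) {W : Set A} (hW : W ∈ 𝓝 (0 : A)) :
    ∃ K : AddSubgroup A, IsOpen (K : Set A) ∧ (K : Set A) ⊆ W := by
  have := hA.locallyCompact
  have := hA.totallyDisconnected
  obtain ⟨H, hH, hHo, -⟩ := exists_compact_open_addSubgroup hA.compact_closure
    (isCompact_singleton (x := (0 : A)))
  have : CompactSpace H := isCompact_iff_compactSpace.1 hH
  have hW0 : ((↑) : H → A) ⁻¹' W ∈ 𝓝 (0 : H) :=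
    continuous_subtype_val.continuousAt.preimage_mem_nhds hW
  obtain ⟨W', ⟨h0, hc⟩, hW'⟩ := (nhds_basis_clopen (0 : H)).mem_iff.1 hW0
  obtain ⟨U, hU⟩ := IsTopologicalAddGroup.exist_openAddSubgroup_sub_clopen_nhds_of_zero hc h0
  refine ⟨U.toAddSubgroup.map H.subtype, hHo.isOpenMap_subtype_val _ U.isOpen', ?_⟩
  rintro _ ⟨x, hx, rfl⟩
  exact hW' (hU hx)

end Periodic

/-! ### The module structure over the profinite integers and the primary decomposition -/

section PeriodicModule

lemma continuous_single_profiniteInt (p : Nat.Primes) :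
    Continuous fun x : ℤ_[(p : ℕ)] => (Pi.single p x : ProfiniteInt) :=
  continuous_single (A := fun q : Nat.Primes => ℤ_[(q : ℕ)]) p

lemma hasSum_single_profiniteInt (z : ProfiniteInt) :
    HasSum (fun p : Nat.Primes => (Pi.single p (z p) : ProfiniteInt)) z := by
  refine Pi.hasSum.2 fun q => ?_
  convert hasSum_single q (f := fun p : Nat.Primes => (Pi.single p (z p) : ProfiniteInt) q) ?_ using 1
  · simp
  · intro p hp
    exact Pi.single_eq_of_ne hp.symm _

lemma profiniteInt_hom_ext {A : Type*} [AddCommGroup A] [TopologicalSpace A] [T2Space A]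
    {φ ψ : ProfiniteInt →+ A} (hφ : Continuous φ) (hψ : Continuous ψ)
    (h : φ 1 = ψ 1) : φ = ψ := by
  refine DFunLike.coe_injective (denseRange_intCast_profiniteInt.equalizer hφ hψ ?_)
  funext n
  have e : ((n : ℤ) : ProfiniteInt) = n • (1 : ProfiniteInt) := by simp
  simp only [Function.comp, e, map_zsmul, h]

variable {A : Type*} [AddCommGroup A] [TopologicalSpace A] [IsTopologicalAddGroup A] [T2Space A]

variable [hA : Fact (IsPeriodic A)]

/-- The continuous homomorphism `z ↦ z • g` from the profinite integers with `1 ↦ g`. -/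
noncomputable def profiniteHom (g : A) : ProfiniteInt →+ A := (hA.out.exists_hom g).choose

lemma continuous_profiniteHom (g : A) : Continuous (profiniteHom g) :=
  (hA.out.exists_hom g).choose_spec.1

lemma profiniteHom_one (g : A) : profiniteHom g 1 = g := (hA.out.exists_hom g).choose_spec.2

lemma profiniteHom_unique {g : A} {φ : ProfiniteInt →+ A} (hφ : Continuous φ) (h : φ 1 = g) :
    φ = profiniteHom g :=
  profiniteInt_hom_ext hφ (continuous_profiniteHom g) (h.trans (profiniteHom_one g).symm)

/-- A periodic group is a module over the profinite integers. -/
noncomputable instance : Module ProfiniteInt A where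
  smul z g := profiniteHom g z
  one_smul g := profiniteHom_one g
  mul_smul z w g := by
    change profiniteHom g (z * w) = profiniteHom (profiniteHom g w) z
    rw [← profiniteHom_unique (g := profiniteHom g w)
      (φ := (profiniteHom g).comp (AddMonoidHom.mulRight w))
      ((continuous_profiniteHom g).comp (continuous_mul_const w)) (by simp)]
    rfl
  smul_zero z := by
    change profiniteHom (0 : A) z = 0
    rw [← profiniteHom_unique (g := (0 : A)) (φ := 0) continuous_const rfl]
    rfl
  smul_add z g h := by
    change profiniteHom (g + h) z = profiniteHom g z + profiniteHom h z
    rw [← profiniteHom_unique (g := g + h) (φ := profiniteHom g + profiniteHom h)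
      ((continuous_profiniteHom g).add (continuous_profiniteHom h))
      (by simp [profiniteHom_one])]
    rfl
  add_smul z w g := map_add (profiniteHom g) z w
  zero_smul g := map_zero (profiniteHom g)

lemma continuous_smul_left (g : A) : Continuous fun z : ProfiniteInt => z • g :=
  continuous_profiniteHom g

/-- Closed subgroups are stable under all scalars, so a small open subgroup controls `z • (g - g₀)`
uniformly in `z`; the remaining term `z • g₀` is continuous in `z`. -/
instance : ContinuousSMul ProfiniteInt A where
  continuous_smul := by
    rw [continuous_iff_continuousAt]
    rintro ⟨z₀, g₀⟩
    have hmem : ∀ (K : AddSubgroup A), IsClosed (K : Set A) → ∀ (z : ProfiniteInt), ∀ x ∈ K,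
        z • x ∈ K := fun K hK z x hx => by
      refine denseRange_intCast_profiniteInt.induction_on (p := fun z => z • x ∈ K) z
        (hK.preimage (continuous_smul_left x)) fun n => ?_
      rw [Int.cast_smul_eq_zsmul]
      exact K.zsmul_mem hx n
    have e : (fun q : ProfiniteInt × A => q.1 • q.2)
        = fun q => q.1 • (q.2 - g₀) + q.1 • g₀ := by
      funext q
      rw [smul_sub, sub_add_cancel]
    rw [e]
    refine ContinuousAt.add ?_ ((continuous_smul_left g₀).comp continuous_fst).continuousAt
    rw [ContinuousAt, sub_self, smul_zero]
    intro W hW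
    rw [mem_map]
    obtain ⟨K, hK, hKW⟩ := hA.out.exists_isOpen_addSubgroup_subset hW
    have hcont : Continuous fun q : ProfiniteInt × A => q.2 - g₀ :=
      continuous_snd.sub continuous_const
    filter_upwards [(hK.preimage hcont).mem_nhds (x := (z₀, g₀)) (by simp [K.zero_mem])] with q hq
    exact hKW (hmem K (K.isClosed_of_isOpen hK) q.1 _ hq)

/-- Both sides are continuous homomorphisms in `z` with value `a` at `1`. -/
lemma smul_primaryComponent {p : Nat.Primes} (z : ProfiniteInt) (a : primaryComponent A (p : ℕ)) :
    z • (a : A) = ((z p • a : primaryComponent A (p : ℕ)) : A) := by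
  change profiniteHom (a : A) z = scalarHom a (z p)
  rw [← profiniteHom_unique (g := (a : A))
    (φ := (scalarHom a).comp (Pi.evalAddMonoidHom (fun p : Nat.Primes => ℤ_[(p : ℕ)]) p))
    ((continuous_scalarHom a).comp (continuous_apply p)) (scalarHom_one a)]
  rfl

lemma coe_smul_eq_single_smul {p : Nat.Primes} (x : ℤ_[(p : ℕ)])
    (a : primaryComponent A (p : ℕ)) :
    ((x • a : primaryComponent A (p : ℕ)) : A) = (Pi.single p x : ProfiniteInt) • (a : A) := by
  rw [smul_primaryComponent, Pi.single_eq_same]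

lemma single_smul_mem (p : Nat.Primes) (x : ℤ_[(p : ℕ)]) (g : A) :
    (Pi.single p x : ProfiniteInt) • g ∈ primaryComponent A (p : ℕ) := by
  have h : ((Pi.single p 1 : ProfiniteInt)) • g ∈ primaryComponent A (p : ℕ) :=
    isPElement_iff.2 ⟨(profiniteHom g).comp
      (AddMonoidHom.single (fun p : Nat.Primes => ℤ_[(p : ℕ)]) p),
      (continuous_profiniteHom g).comp (continuous_single_profiniteInt p), rfl⟩
  have e : (Pi.single p x : ProfiniteInt) = Pi.single p x * Pi.single p 1 := by
    rw [← Pi.single_mul, mul_one]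
  rw [e, mul_smul, smul_primaryComponent (p := p) _ ⟨_, h⟩]
  exact Subtype.property _

/-- The `p`-primary part of an element. -/
noncomputable def primaryPart (p : Nat.Primes) (g : A) : primaryComponent A (p : ℕ) :=
  ⟨(Pi.single p 1 : ProfiniteInt) • g, single_smul_mem p 1 g⟩

/-- The continuous homomorphism `z ↦ z • g` is applied to the unconditional sum of the coordinates
of `z`. -/
lemma isPrimaryDecomposition_smul (z : ProfiniteInt) (g : A) :
    IsPrimaryDecomposition (z • g) fun p => z p • primaryPart p g := by
  have h := (hasSum_single_profiniteInt z).map (profiniteHom g) (continuous_profiniteHom g)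
  have e : (profiniteHom g ∘ fun p : Nat.Primes => (Pi.single p (z p) : ProfiniteInt))
      = fun p : Nat.Primes => ((z p • primaryPart p g : primaryComponent A (p : ℕ)) : A) := by
    funext p
    rw [coe_smul_eq_single_smul]
    change (Pi.single p (z p) : ProfiniteInt) • g
      = (Pi.single p (z p) : ProfiniteInt) • ((Pi.single p 1 : ProfiniteInt) • g)
    rw [smul_smul, ← Pi.single_mul, mul_one]
  rw [e] at h
  exact h

/-- Uniqueness: the idempotent at `q` fixes the `q`-th summand and kills all others. -/
lemma isPrimaryDecomposition_iff {g : A} {c : ∀ p : Nat.Primes, primaryComponent A (p : ℕ)} :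
    IsPrimaryDecomposition g c ↔ c = fun p => primaryPart p g := by
  constructor
  · intro h
    funext q
    refine Subtype.ext ?_
    have h1 := h.map (DistribSMul.toAddMonoidHom A (Pi.single q 1 : ProfiniteInt))
      (continuous_const_smul _)
    have h2 : ∀ p, (Pi.single q 1 : ProfiniteInt) • (c p : A)
        = (((Pi.single q 1 : ProfiniteInt) p • c p : primaryComponent A (p : ℕ)) : A) :=
      fun p => smul_primaryComponent _ _
    have h3 : HasSum (fun p => (Pi.single q 1 : ProfiniteInt) • (c p : A)) (c q : A) := by
      convert hasSum_single q ?_ using 1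
      · rw [h2, Pi.single_eq_same, one_smul]
      · intro p hp
        rw [h2, Pi.single_eq_of_ne hp, zero_smul, AddSubgroup.coe_zero]
    exact h3.unique h1
  · rintro rfl
    simpa using isPrimaryDecomposition_smul 1 g

lemma isScalarMultiple_iff {z : ProfiniteInt} {g h : A} : IsScalarMultiple z g h ↔ h = z • g := by
  constructor
  · rintro ⟨c, hc, hd⟩
    rw [isPrimaryDecomposition_iff] at hc
    subst hc
    exact hd.unique (isPrimaryDecomposition_smul z g)
  · rintro rfl
    exact ⟨_, isPrimaryDecomposition_iff.2 rfl, isPrimaryDecomposition_smul z g⟩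

/-- `A_p` is the set of fixed points of its idempotent. -/
lemma isClosed_primaryComponent (p : Nat.Primes) :
    IsClosed (primaryComponent A (p : ℕ) : Set A) := by
  have : (primaryComponent A (p : ℕ) : Set A)
      = {g | (Pi.single p 1 : ProfiniteInt) • g = g} := by
    ext g
    refine ⟨fun hg => ?_, fun hg => ?_⟩
    · rw [Set.mem_ofPred_eq, smul_primaryComponent (p := p) _ ⟨g, hg⟩, Pi.single_eq_same, one_smul]
    · rw [← show _ = g from hg]
      exact single_smul_mem p 1 g
  rw [this]
  exact isClosed_eq (continuous_const_smul _) continuous_id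

instance (p : Nat.Primes) : ContinuousSMul ℤ_[(p : ℕ)] (primaryComponent A (p : ℕ)) where
  continuous_smul := by
    refine continuous_induced_rng.2 ?_
    have e : (((↑) : primaryComponent A (p : ℕ) → A) ∘
        fun q : ℤ_[(p : ℕ)] × primaryComponent A (p : ℕ) => q.1 • q.2)
        = fun q => (Pi.single p q.1 : ProfiniteInt) • (q.2 : A) :=
      funext fun q => coe_smul_eq_single_smul q.1 q.2
    rw [e]
    exact ((continuous_single_profiniteInt p).comp continuous_fst).smul
      (continuous_subtype_val.comp continuous_snd)

end PeriodicModule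

/-! ### Scalar automorphisms of topological `ℤ_p`-modules -/

section PadicScalars

variable {p : ℕ} [hp : Fact p.Prime] {M : Type*} [AddCommGroup M] [TopologicalSpace M] [T2Space M]
  [Module ℤ_[p] M] [ContinuousSMul ℤ_[p] M]

/-- The orbit `ℤ_p • x` is a compact, hence closed, subgroup. -/
lemma SAut.exists_padic_smul_apply (α : SAut M) (x : M) :
    ∃ t : ℤ_[p], (α : M ≃L[ℤ] M) x = t • x := by
  have hcl : IsClosed ((LinearMap.range (LinearMap.toSpanSingleton ℤ_[p] M x)).toAddSubgroup :
      Set M) := by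
    change IsClosed (Set.range fun t : ℤ_[p] => t • x)
    exact (isCompact_range (continuous_id.smul continuous_const)).isClosed
  obtain ⟨t, ht⟩ := SAut.apply_mem α hcl (x := x) ⟨1, one_smul _ x⟩
  exact ⟨t, ht.symm⟩

/-- A scalar automorphism as a `ℤ_p`-linear map. -/
def SAut.toPadicLinearMap (α : SAut M) : M →ₗ[ℤ_[p]] M where
  toFun := (α : M ≃L[ℤ] M)
  map_add' := map_add (α : M ≃L[ℤ] M)
  map_smul' := fun t x => map_smul_of_continuous PadicInt.denseRange_intCast
    ((α : M ≃L[ℤ] M) : M →+ M) (α : M ≃L[ℤ] M).continuous t x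

lemma SAut.apply_eq_smul_of_annihilator_le (α : SAut M) {a b : M}
    (hab : ∀ t : ℤ_[p], t • a = 0 → t • b = 0) {u : ℤ_[p]} (hu : (α : M ≃L[ℤ] M) a = u • a) :
    (α : M ≃L[ℤ] M) b = u • b := by
  have h := eq_zero_of_annihilator_le
    (β := SAut.toPadicLinearMap α - u • (LinearMap.id : M →ₗ[ℤ_[p]] M)) (fun x => by
      obtain ⟨t, ht⟩ := SAut.exists_padic_smul_apply (p := p) α x
      refine ⟨t - u, ?_⟩
      rw [sub_smul, ← ht]
      rfl) (a := a) (b := b) (sub_eq_zero.2 hu) hab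
  exact sub_eq_zero.1 h

-- The sets `{u | α a = u • a}` are nonempty and compact. Annihilators are ideals of a valuation
-- ring and form a chain, so these sets are directed downwards and have a common point.
variable (p) in
lemma SAut.exists_padic_smul (α : SAut M) : ∃ u : ℤ_[p], ∀ x, (α : M ≃L[ℤ] M) x = u • x := by
  have hne := IsCompact.nonempty_iInter_of_directed_nonempty_isCompact_isClosed
    (fun a : M => {u : ℤ_[p] | (α : M ≃L[ℤ] M) a = u • a}) (by
      intro a b
      rcases (ValuationRing.le_total_ideal (A := ℤ_[p])).total
        (LinearMap.ker (LinearMap.toSpanSingleton ℤ_[p] M a))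
        (LinearMap.ker (LinearMap.toSpanSingleton ℤ_[p] M b)) with h | h
      · exact ⟨a, subset_rfl, fun u hu => SAut.apply_eq_smul_of_annihilator_le α
          (fun t ht => h ht) hu⟩
      · exact ⟨b, fun u hu => SAut.apply_eq_smul_of_annihilator_le α
          (fun t ht => h ht) hu, subset_rfl⟩)
    (fun a => SAut.exists_padic_smul_apply α a)
    (fun a => (isClosed_eq continuous_const (continuous_id.smul continuous_const)).isCompact)
    (fun a => isClosed_eq continuous_const (continuous_id.smul continuous_const))
  obtain ⟨u, hu⟩ := hne
  exact ⟨u, fun x => Set.mem_iInter.1 hu x⟩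

variable (p) in
/-- Each scalar automorphism of a `ℤ_p`-module is multiplication by a unit. -/
lemma SAut.surjective_ofUnits_padic :
    Function.Surjective (SAut.ofUnits PadicInt.denseRange_intCast : ℤ_[p]ˣ → SAut M) := by
  intro α
  obtain ⟨u, hu⟩ := SAut.exists_padic_smul p α
  obtain ⟨v, hv⟩ := SAut.exists_padic_smul p α⁻¹
  by_cases hunit : IsUnit u
  · obtain ⟨u, rfl⟩ := hunit
    exact ⟨u, Subtype.ext (ContinuousLinearEquiv.ext (funext fun x => (hu x).symm))⟩
  -- A nonunit `u` forces `M = 0`: `v * u` acts as the identity, while `1 - v * u` is a unit of the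
  -- local ring.
  · have h1 : IsUnit (1 - v * u) := by
      rcases IsLocalRing.isUnit_or_isUnit_of_add_one (sub_add_cancel 1 (v * u)) with h | h
      · exact h
      · exact absurd (isUnit_of_mul_isUnit_right h) hunit
    have hz : ∀ x : M, x = 0 := fun x => by
      have h2 : (v * u) • x = x := by
        rw [mul_smul, ← hu, ← hv]
        exact (α : M ≃L[ℤ] M).symm_apply_apply x
      have h3 : (1 - v * u) • x = 0 := by rw [sub_smul, one_smul, h2, sub_self]
      exact (h1.smul_eq_zero).1 h3
    exact ⟨1, Subtype.ext (ContinuousLinearEquiv.ext (funext fun x => by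
      rw [hz x]; exact (map_zero _).trans (map_zero _).symm))⟩

end PadicScalars

/-! ### Exponents and annihilators -/

section Exponent

variable {p : ℕ} [hp : Fact p.Prime] {M : Type*} [AddCommGroup M] [Module ℤ_[p] M]

lemma exponent_dvd_pow_valuation {x : ℤ_[p]} (hx : x ≠ 0) (h : ∀ a : M, x • a = 0) :
    AddMonoid.exponent M ∣ p ^ x.valuation := by
  refine AddMonoid.exponent_dvd_of_forall_nsmul_eq_zero fun a => ?_
  have h1 := h a
  rw [PadicInt.unitCoeff_spec hx, mul_smul, (PadicInt.unitCoeff hx).isUnit.smul_eq_zero] at h1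
  rw [← h1, ← Nat.cast_smul_eq_nsmul ℤ_[p], Nat.cast_pow]

lemma eq_zero_of_exponent_eq_zero (he : AddMonoid.exponent M = 0) {x : ℤ_[p]}
    (h : ∀ a : M, x • a = 0) : x = 0 := by
  by_contra hx
  have := exponent_dvd_pow_valuation hx h
  rw [he, zero_dvd_iff] at this
  exact pow_ne_zero _ hp.out.ne_zero this

variable (p M) in
lemma exists_exponent_eq_pow (he : AddMonoid.exponent M ≠ 0) :
    ∃ m : ℕ, AddMonoid.exponent M = p ^ m := by
  have h := exponent_dvd_pow_valuation (M := M) (x := (AddMonoid.exponent M : ℤ_[p]))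
    (by exact_mod_cast he) fun a => by
      rw [Nat.cast_smul_eq_nsmul, AddMonoid.exponent_nsmul_eq_zero]
  obtain ⟨m, -, hm⟩ := (Nat.dvd_prime_pow hp.out).1 h
  exact ⟨m, hm⟩

lemma forall_smul_eq_zero_iff {m : ℕ} (he : AddMonoid.exponent M = p ^ m) (x : ℤ_[p]) :
    (∀ a : M, x • a = 0) ↔ x ∈ Ideal.span {(p : ℤ_[p]) ^ m} := by
  rw [Ideal.mem_span_singleton]
  constructor
  · intro h
    by_cases hx : x = 0
    · rw [hx]; exact dvd_zero _
    · have h1 := exponent_dvd_pow_valuation hx h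
      rw [he] at h1
      rw [PadicInt.unitCoeff_spec hx]
      exact Dvd.dvd.mul_left (by exact_mod_cast Nat.cast_dvd_cast (α := ℤ_[p]) h1) _
  · rintro ⟨y, rfl⟩ a
    rw [mul_comm, mul_smul, ← Nat.cast_pow, Nat.cast_smul_eq_nsmul, ← he,
      AddMonoid.exponent_nsmul_eq_zero, smul_zero]

end Exponent

/-! ### Finite quotients of `ℤ_p` and their units -/

section Quotient

lemma exists_mulEquiv_of_ker_eq {G H K : Type*} [Group G] [Group H] [Group K] {φ : G →* H}
    {ψ : G →* K} (hφ : Function.Surjective φ) (hψ : Function.Surjective ψ) (h : φ.ker = ψ.ker) :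
    ∃ e : H ≃* K, ∀ g, e (φ g) = ψ g := by
  refine ⟨(QuotientGroup.quotientKerEquivOfSurjective φ hφ).symm.trans
    ((QuotientGroup.quotientMulEquivOfEq h).trans
      (QuotientGroup.quotientKerEquivOfSurjective ψ hψ)), fun g => ?_⟩
  have : (QuotientGroup.quotientKerEquivOfSurjective φ hφ).symm (φ g) = (g : G ⧸ φ.ker) :=
    (MulEquiv.symm_apply_eq _).2 rfl
  rw [MulEquiv.trans_apply, this]
  rfl

variable {p : ℕ} [hp : Fact p.Prime]

/-- The quotients of the `p`-adic integers. -/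
noncomputable def quotientSpanPowEquiv (m : ℕ) :
    (ℤ_[p] ⧸ Ideal.span {(p : ℤ_[p]) ^ m}) ≃+* ZMod (p ^ m) :=
  (Ideal.quotEquivOfEq (PadicInt.ker_toZModPow m).symm).trans
    (RingHom.quotientKerEquivOfSurjective (f := PadicInt.toZModPow (p := p) m)
      (ZMod.ringHom_surjective _))

instance (m : ℕ) : Finite (ℤ_[p] ⧸ Ideal.span {(p : ℤ_[p]) ^ m}) :=
  have : NeZero (p ^ m) := ⟨pow_ne_zero _ hp.out.ne_zero⟩
  Finite.of_equiv _ (quotientSpanPowEquiv m).symm.toEquiv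

instance (m : ℕ) : DiscreteTopology (ℤ_[p] ⧸ Ideal.span {(p : ℤ_[p]) ^ m}) :=
  QuotientAddGroup.discreteTopology (isOpen_span_pow m)

/-- A surjection of a local ring onto a nonzero ring reflects units. For `m = 0` the quotient is the
zero ring. -/
lemma surjective_units_map_quotient (m : ℕ) : Function.Surjective
    (Units.map (Ideal.Quotient.mk (Ideal.span {(p : ℤ_[p]) ^ m})).toMonoidHom) := by
  rcases Nat.eq_zero_or_pos m with rfl | hm
  · intro u
    have : Subsingleton (ℤ_[p] ⧸ Ideal.span {(p : ℤ_[p]) ^ 0}) :=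
      Ideal.Quotient.subsingleton_iff.2 (by simp)
    exact ⟨1, Subsingleton.elim _ _⟩
  · have : Nontrivial (ℤ_[p] ⧸ Ideal.span {(p : ℤ_[p]) ^ m}) := by
      refine Ideal.Quotient.nontrivial_iff.2 fun h => ?_
      rw [Ideal.span_singleton_eq_top, isUnit_pow_iff hm.ne'] at h
      exact PadicInt.p_nonunit h
    exact IsLocalRing.surjective_units_map_of_local_ringHom _ Ideal.Quotient.mk_surjective
      (IsLocalHom.of_surjective _ Ideal.Quotient.mk_surjective)

end Quotient

/-! ### Scalar automorphisms of periodic groups -/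

section PeriodicScalars

variable {A : Type*} [AddCommGroup A] [TopologicalSpace A] [IsTopologicalAddGroup A] [T2Space A]
  [hA : Fact (IsPeriodic A)]

lemma hasSum_primaryPart (g : A) : HasSum (fun p : Nat.Primes => (primaryPart p g : A)) g :=
  isPrimaryDecomposition_iff.2 rfl

/-- A scalar automorphism is determined by its values on the primary components. -/
lemma SAut.ext_primaryComponent {α β : SAut A}
    (h : ∀ (p : Nat.Primes) (a : primaryComponent A (p : ℕ)),
      (α : A ≃L[ℤ] A) a = (β : A ≃L[ℤ] A) a) : α = β := by
  refine Subtype.ext (ContinuousLinearEquiv.ext (funext fun g => ?_))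
  have h1 := (hasSum_primaryPart g).map (α : A ≃L[ℤ] A) (α : A ≃L[ℤ] A).continuous
  have h2 := (hasSum_primaryPart g).map (β : A ≃L[ℤ] A) (β : A ≃L[ℤ] A).continuous
  have e : ((α : A ≃L[ℤ] A) ∘ fun p : Nat.Primes => (primaryPart p g : A))
      = (β : A ≃L[ℤ] A) ∘ fun p : Nat.Primes => (primaryPart p g : A) :=
    funext fun p => h p _
  rw [e] at h1
  exact h1.unique h2

variable (A) in
/-- The restriction of scalar automorphisms to the primary components. -/
noncomputable def SAut.toPrimaryComponents :
    SAut A →* ∀ p : Nat.Primes, SAut (primaryComponent A (p : ℕ)) :=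
  MonoidHom.pi fun p => SAut.restrict (primaryComponent A (p : ℕ)) (isClosed_primaryComponent p)

variable (A) in
/-- The scalar automorphism given by multiplication by a unit of the profinite integers. -/
noncomputable def SAut.ofProfiniteUnits : ProfiniteIntˣ →* SAut A :=
  SAut.ofUnits denseRange_intCast_profiniteInt

lemma SAut.ofProfiniteUnits_apply (z : ProfiniteIntˣ) (g : A) :
    (SAut.ofProfiniteUnits A z : A ≃L[ℤ] A) g = (z : ProfiniteInt) • g := rfl

variable (A) in
lemma SAut.continuous_ofProfiniteUnits : Continuous (SAut.ofProfiniteUnits A) :=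
  SAut.continuous_ofUnits _

lemma SAut.toPrimaryComponents_ofProfiniteUnits (z : ProfiniteIntˣ) :
    SAut.toPrimaryComponents A (SAut.ofProfiniteUnits A z)
      = fun p : Nat.Primes => SAut.ofUnits PadicInt.denseRange_intCast (MulEquiv.piUnits z p) := by
  funext p
  refine Subtype.ext (ContinuousLinearEquiv.ext (funext fun a => Subtype.ext ?_))
  exact smul_primaryComponent (z : ProfiniteInt) a

lemma SAut.toPrimaryComponents_injective : Function.Injective (SAut.toPrimaryComponents A) := by
  intro α β h
  refine SAut.ext_primaryComponent fun p a => ?_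
  have h1 : SAut.restrict _ (isClosed_primaryComponent p) α
    = SAut.restrict _ (isClosed_primaryComponent p) β := congrFun h p
  rw [← SAut.coe_restrict_apply _ (isClosed_primaryComponent p) α a, h1,
    SAut.coe_restrict_apply]

/-- Each `β p` is multiplication by a unit of `ℤ_p`, and any family of units is a unit of the
product ring. -/
lemma SAut.exists_toPrimaryComponents_ofProfiniteUnits
    (β : ∀ p : Nat.Primes, SAut (primaryComponent A (p : ℕ))) :
    ∃ z : ProfiniteIntˣ, SAut.toPrimaryComponents A (SAut.ofProfiniteUnits A z) = β := by
  choose u hu using fun p : Nat.Primes => SAut.surjective_ofUnits_padic (p : ℕ) (β p)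
  refine ⟨MulEquiv.piUnits.symm u, ?_⟩
  rw [SAut.toPrimaryComponents_ofProfiniteUnits, MulEquiv.apply_symm_apply]
  exact funext hu

variable (A) in
lemma SAut.surjective_ofProfiniteUnits : Function.Surjective (SAut.ofProfiniteUnits A) := by
  intro α
  obtain ⟨z, hz⟩ := SAut.exists_toPrimaryComponents_ofProfiniteUnits (SAut.toPrimaryComponents A α)
  exact ⟨z, SAut.toPrimaryComponents_injective hz⟩

variable (A) in
lemma SAut.isQuotientMap_ofProfiniteUnits : IsQuotientMap (SAut.ofProfiniteUnits A) :=
  (SAut.continuous_ofProfiniteUnits A).isClosedMap.isQuotientMap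
    (SAut.continuous_ofProfiniteUnits A) (SAut.surjective_ofProfiniteUnits A)

/-- Continuity is tested on the units, through the quotient map; this avoids comparing the
compact-open topologies of `A` and `A_p`. -/
lemma SAut.continuous_toPrimaryComponents : Continuous (SAut.toPrimaryComponents A) := by
  rw [(SAut.isQuotientMap_ofProfiniteUnits A).continuous_iff]
  have e : SAut.toPrimaryComponents A ∘ SAut.ofProfiniteUnits A
      = fun z p => SAut.ofUnits PadicInt.denseRange_intCast (MulEquiv.piUnits z p) :=
    funext SAut.toPrimaryComponents_ofProfiniteUnits
  rw [e]
  refine continuous_pi fun p => (SAut.continuous_ofUnits _).comp ?_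
  exact (continuous_apply p).comp (ContinuousMulEquiv.piUnits
    (M := fun p : Nat.Primes => ℤ_[(p : ℕ)])).continuous_toFun

end PeriodicScalars

/-- A continuous bijective homomorphism from a compact to a Hausdorff group. -/
noncomputable def continuousMulEquivOfBijective {G H : Type*} [Group G] [Group H]
    [TopologicalSpace G] [TopologicalSpace H] [CompactSpace G] [T2Space H] (f : G →* H)
    (hc : Continuous f) (hf : Function.Bijective f) : G ≃ₜ* H :=
  { MulEquiv.ofBijective f hf with
    continuous_toFun := hc
    continuous_invFun := Continuous.continuous_symm_of_equiv_compact_to_t2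
      (f := (MulEquiv.ofBijective f hf).toEquiv) hc }

/-! ### A sign character on the profinite units -/

section Sign

/-- Reduction of profinite integers modulo a prime power. -/
noncomputable def profiniteIntToZMod (p : Nat.Primes) (m : ℕ) :
    ProfiniteInt →+* ZMod ((p : ℕ) ^ m) :=
  (PadicInt.toZModPow (p := (p : ℕ)) m).comp
    (Pi.evalRingHom (fun p : Nat.Primes => ℤ_[(p : ℕ)]) p)

lemma continuous_units_map_profiniteIntToZMod (p : Nat.Primes) (m : ℕ)
    (χ : ZMod ((p : ℕ) ^ m) →* ℤ) :
    Continuous (Units.map (χ.comp (profiniteIntToZMod p m).toMonoidHom)) := by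
  refine continuous_of_continuousAt_one _ ?_
  have hcont : Continuous fun u : ProfiniteIntˣ => (u : ProfiniteInt) p - 1 :=
    ((continuous_apply p).comp Units.continuous_val).sub continuous_const
  have hopen := (isOpen_span_pow (p := (p : ℕ)) m).preimage hcont
  rw [ContinuousAt, map_one]
  refine tendsto_const_nhds.congr' ?_
  filter_upwards [hopen.mem_nhds (x := 1) (by simp)] with u hu
  refine Units.ext ?_
  have h1 : profiniteIntToZMod p m u = 1 := by
    rw [← sub_eq_zero, ← map_one (profiniteIntToZMod p m), ← map_sub]
    rw [Set.mem_preimage, SetLike.mem_coe, ← PadicInt.ker_toZModPow, RingHom.mem_ker] at hu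
    exact hu
  change 1 = χ (profiniteIntToZMod p m u)
  rw [h1, map_one]

/-- The units of the profinite integers have a continuous homomorphism onto `{1, -1}`, given by
reduction modulo `4`. -/
lemma exists_surjective_sign : ∃ σ : ProfiniteIntˣ →* ℤˣ, Continuous σ ∧ Function.Surjective σ := by
  let χ : ZMod (2 ^ 2) →* ℤ := ZMod.χ₄.toMonoidHom
  refine ⟨_, continuous_units_map_profiniteIntToZMod ⟨2, Nat.prime_two⟩ 2 χ, fun u => ?_⟩
  rcases Int.units_eq_one_or u with rfl | rfl
  · exact ⟨1, map_one _⟩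
  · refine ⟨-1, Units.ext ?_⟩
    have h1 : profiniteIntToZMod ⟨2, Nat.prime_two⟩ 2 (-1) = -1 := by rw [map_neg, map_one]
    refine (congrArg χ h1).trans ?_
    decide

/-- If all scalar automorphisms are trivial, the group `SAut(A)` is a quotient of the group of units
of the profinite integers. -/
lemma exists_isQuotientMap_of_eq {A : Type*} [AddCommGroup A] [TopologicalSpace A]
    [IsTopologicalAddGroup A] [T2Space A]
    (h : (SAut A : Set (A ≃L[ℤ] A)) = {1, ContinuousLinearEquiv.neg ℤ}) :
    ∃ μ : ProfiniteIntˣ →* SAut A, IsQuotientMap μ := by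
  obtain ⟨σ, hσ, hs⟩ := exists_surjective_sign
  -- `A` is regarded as a module over the discrete ring `ℤ`, whose units act as `±id`.
  have hd : DenseRange (Int.cast : ℤ → ℤ) := Function.Surjective.denseRange fun n => ⟨n, rfl⟩
  have hc : Continuous ((SAut.ofUnits hd : ℤˣ →* SAut A).comp σ) :=
    (SAut.continuous_ofUnits hd).comp hσ
  have hsurj : Function.Surjective (SAut.ofUnits hd : ℤˣ →* SAut A) := fun α => by
    have hα : (α : A ≃L[ℤ] A) ∈ ({1, ContinuousLinearEquiv.neg ℤ} : Set (A ≃L[ℤ] A)) := h ▸ α.2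
    rcases hα with e | e
    · exact ⟨1, (map_one _).trans (Subtype.ext e.symm)⟩
    · refine ⟨-1, Subtype.ext (ContinuousLinearEquiv.ext (funext fun x => ?_))⟩
      rw [Set.mem_singleton_iff.1 e]
      exact (neg_smul _ _).trans (congrArg Neg.neg (one_smul ℤ x))
  exact ⟨_, hc.isClosedMap.isQuotientMap hc (hsurj.comp hs)⟩

end Sign

end LCA

/-! ### The classification -/

theorem mainTheorem8 (A : Type*) [AddCommGroup A] [TopologicalSpace A] [IsTopologicalAddGroup A]
    [LocallyCompactSpace A] [T2Space A] :
    -- (a) the non-periodic case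
    (¬ LCA.IsPeriodic A →
      (LCA.SAut A : Set (A ≃L[ℤ] A)) = {1, ContinuousLinearEquiv.neg ℤ}) ∧
    -- (c) `SAut(A)` is a homomorphic image of the unit group of the profinite integers
    (∃ μ : LCA.ProfiniteIntˣ →* LCA.SAut A, Topology.IsQuotientMap μ) ∧
    (LCA.IsPeriodic A →
      -- every element has a unique decomposition into its primary components
      (∀ g : A, ∃! c, LCA.IsPrimaryDecomposition g c) ∧
      -- (b) restriction to the primary components is an isomorphism `SAut(A) = ∏_p SAut(A_p)`
      (∃ e : LCA.SAut A ≃ₜ* (∀ p : Nat.Primes, LCA.SAut (LCA.primaryComponent A (p : ℕ))),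
        ∀ (α : LCA.SAut A) (p : Nat.Primes) (a : LCA.primaryComponent A (p : ℕ)),
          (((e α p : LCA.primaryComponent A (p : ℕ) ≃L[ℤ] LCA.primaryComponent A (p : ℕ)) a :
            LCA.primaryComponent A (p : ℕ)) : A) = (α : A ≃L[ℤ] A) (a : A)) ∧
      -- (b) `SAut(A_p)` is the unit group of `ℤ_p` if `A_p` has infinite exponent
      (∀ p : Nat.Primes, AddMonoid.exponent (LCA.primaryComponent A (p : ℕ)) = 0 →
        ∃ e : ℤ_[(p : ℕ)]ˣ ≃ₜ* LCA.SAut (LCA.primaryComponent A (p : ℕ)),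
          ∀ (u : ℤ_[(p : ℕ)]ˣ) (a : LCA.primaryComponent A (p : ℕ)),
            (e u : LCA.primaryComponent A (p : ℕ) ≃L[ℤ] LCA.primaryComponent A (p : ℕ)) a
              = (u : ℤ_[(p : ℕ)]) • a) ∧
      -- (b) and of `ℤ_p / p ^ m ℤ_p ≅ ℤ / p ^ m ℤ`, where `p ^ m` is the exponent, otherwise
      (∀ p : Nat.Primes, AddMonoid.exponent (LCA.primaryComponent A (p : ℕ)) ≠ 0 →
        ∃ m : ℕ, AddMonoid.exponent (LCA.primaryComponent A (p : ℕ)) = (p : ℕ) ^ m ∧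
          Nonempty ((ℤ_[(p : ℕ)] ⧸ Ideal.span {((p : ℕ) : ℤ_[(p : ℕ)]) ^ m}) ≃+*
            ZMod ((p : ℕ) ^ m)) ∧
          ∃ e : (ℤ_[(p : ℕ)] ⧸ Ideal.span {((p : ℕ) : ℤ_[(p : ℕ)]) ^ m})ˣ ≃ₜ*
              LCA.SAut (LCA.primaryComponent A (p : ℕ)),
            ∀ (u : ℤ_[(p : ℕ)]ˣ) (a : LCA.primaryComponent A (p : ℕ)),
              (e (Units.map (Ideal.Quotient.mk _).toMonoidHom u) :
                LCA.primaryComponent A (p : ℕ) ≃L[ℤ] LCA.primaryComponent A (p : ℕ)) a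
                = (u : ℤ_[(p : ℕ)]) • a) ∧
      -- (c) in the periodic case, by the map sending a unit `z` to multiplication by `z`
      (∃ μ : LCA.ProfiniteIntˣ →* LCA.SAut A, Topology.IsQuotientMap μ ∧
        ∀ (z : LCA.ProfiniteIntˣ) (g : A),
          LCA.IsScalarMultiple (z : LCA.ProfiniteInt) g ((μ z : A ≃L[ℤ] A) g)) ∧
      -- (d) an automorphism is scalar iff it is multiplication by a unit
      (∀ α : A ≃L[ℤ] A, α ∈ LCA.SAut A ↔
        ∃ z : LCA.ProfiniteIntˣ, ∀ g : A,
          LCA.IsScalarMultiple (z : LCA.ProfiniteInt) g (α g))) := by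
  have hnp : ¬ LCA.IsPeriodic A →
      (LCA.SAut A : Set (A ≃L[ℤ] A)) = {1, ContinuousLinearEquiv.neg ℤ} :=
    LCA.SAut.eq_of_not_isPeriodic
  refine ⟨hnp, ?_, fun hA => ?_⟩
  · by_cases hA : LCA.IsPeriodic A
    · have := Fact.mk hA
      exact ⟨_, LCA.SAut.isQuotientMap_ofProfiniteUnits A⟩
    · exact LCA.exists_isQuotientMap_of_eq (hnp hA)
  have := Fact.mk hA
  -- Compactness makes the restriction to primary components, a continuous bijection onto a
  -- Hausdorff group, a homeomorphism.
  have hcomp : CompactSpace (LCA.SAut A) :=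
    (LCA.SAut.surjective_ofProfiniteUnits A).compactSpace
      (LCA.SAut.continuous_ofProfiniteUnits A)
  refine ⟨fun g => ?_, ?_, fun p he => ?_, fun p he => ?_, ?_, fun α => ⟨fun hα => ?_, ?_⟩⟩
  · exact ⟨_, LCA.isPrimaryDecomposition_iff.2 rfl,
      fun c hc => LCA.isPrimaryDecomposition_iff.1 hc⟩
  · exact ⟨LCA.continuousMulEquivOfBijective (LCA.SAut.toPrimaryComponents A)
      LCA.SAut.continuous_toPrimaryComponents ⟨LCA.SAut.toPrimaryComponents_injective, fun β =>
        let ⟨z, hz⟩ := LCA.SAut.exists_toPrimaryComponents_ofProfiniteUnits β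
        ⟨_, hz⟩⟩, fun α p a => rfl⟩
  · refine ⟨LCA.continuousMulEquivOfBijective
      (LCA.SAut.ofUnits PadicInt.denseRange_intCast) (LCA.SAut.continuous_ofUnits _)
      ⟨(injective_iff_map_eq_one _).2 fun u hu => ?_, LCA.SAut.surjective_ofUnits_padic _⟩,
      fun u a => rfl⟩
    refine Units.ext (sub_eq_zero.1 (LCA.eq_zero_of_exponent_eq_zero he fun a => ?_))
    rw [sub_smul, Units.val_one, one_smul, sub_eq_zero]
    exact congrArg (fun β : LCA.SAut (LCA.primaryComponent A (p : ℕ)) =>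
      (β : LCA.primaryComponent A (p : ℕ) ≃L[ℤ] LCA.primaryComponent A (p : ℕ)) a) hu
  · obtain ⟨m, hm⟩ := LCA.exists_exponent_eq_pow (p : ℕ) (LCA.primaryComponent A (p : ℕ)) he
    refine ⟨m, hm, ⟨LCA.quotientSpanPowEquiv m⟩, ?_⟩
    obtain ⟨e, hemk⟩ := LCA.exists_mulEquiv_of_ker_eq
      (φ := Units.map (Ideal.Quotient.mk
        (Ideal.span {((p : ℕ) : ℤ_[(p : ℕ)]) ^ m})).toMonoidHom)
      (ψ := (LCA.SAut.ofUnits PadicInt.denseRange_intCast :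
        ℤ_[(p : ℕ)]ˣ →* LCA.SAut (LCA.primaryComponent A (p : ℕ))))
      (LCA.surjective_units_map_quotient m) (LCA.SAut.surjective_ofUnits_padic _) (by
        -- Both kernels consist of the units `u` for which `u - 1` is divisible by `p ^ m`, that is,
        -- annihilates `A_p`.
        ext u
        rw [MonoidHom.mem_ker, MonoidHom.mem_ker, Units.ext_iff]
        change Ideal.Quotient.mk _ (u : ℤ_[(p : ℕ)]) = 1 ↔ _
        rw [← map_one (Ideal.Quotient.mk _), Ideal.Quotient.mk_eq_mk_iff_sub_mem,
          ← LCA.forall_smul_eq_zero_iff hm]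
        simp only [sub_smul, one_smul, sub_eq_zero]
        exact ⟨fun h => Subtype.ext (ContinuousLinearEquiv.ext (funext h)),
          fun h a => congrArg (fun β : LCA.SAut (LCA.primaryComponent A (p : ℕ)) =>
            (β : LCA.primaryComponent A (p : ℕ) ≃L[ℤ] LCA.primaryComponent A (p : ℕ)) a) h⟩)
    -- The quotient ring is finite and discrete, so its unit group is compact and `e` is
    -- automatically continuous.
    exact ⟨LCA.continuousMulEquivOfBijective e.toMonoidHom continuous_of_discreteTopology
      e.bijective, fun u a => congrArg (fun β : LCA.SAut (LCA.primaryComponent A (p : ℕ)) =>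
        (β : LCA.primaryComponent A (p : ℕ) ≃L[ℤ] LCA.primaryComponent A (p : ℕ)) a) (hemk u)⟩
  · exact ⟨_, LCA.SAut.isQuotientMap_ofProfiniteUnits A,
      fun z g => LCA.isScalarMultiple_iff.2 rfl⟩
  · obtain ⟨z, hz⟩ := LCA.SAut.surjective_ofProfiniteUnits A ⟨α, hα⟩
    refine ⟨z, fun g => LCA.isScalarMultiple_iff.2 ?_⟩
    rw [← LCA.SAut.ofProfiniteUnits_apply, hz]
  · rintro ⟨z, hz⟩
    have : α = LCA.SAut.ofProfiniteUnits A z :=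
      ContinuousLinearEquiv.ext (funext fun g => LCA.isScalarMultiple_iff.1 (hz g))
    rw [this]
    exact Subtype.property _
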